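/- Let $\kappa$ be an infinite regular cardinal or the symbol $\infty$. A $(\kappa,\kappa)$-frame is a poset with joins and meets of all subsets of size $<\kappa$, in which finite meets distribute over these joins and finite joins distribute over these meets; homomorphisms preserve these joins and meets, and are ordered pointwise. A $\kappa$-Boolean algebra is a $(\kappa,\kappa)$-frame in which every element has a complement. For $\kappa=\infty$, the joins and meets are those of small sets, and the algebras are large (class-sized) ones having a presentation by a small set of generators and a small set of relations (the symbol $\infty$ being treated as an inaccessible cardinal, with small meaning of size $<\infty$). The category $\kappa\mathbf{Bor}^+\mathbf{Loc}$ of positive $\kappa$-Borel locales $X$ is the opposite of the category of $(\kappa,\kappa)$-frames $\mathcal B^+_\kappa(X)$, and the category $\kappa\mathbf{BorLoc}$ of $\kappa$-Borel locales $X$ is the opposite of the category of $\kappa$-Boolean algebras $\mathcal B_\kappa(X)$; for a morphism $f$ write $f^*$ for the corresponding homomorphism. The forgetful functor $\kappa\mathbf{Bor}^+\mathbf{Loc}\to\kappa\mathbf{BorLoc}$ sends $X$ to the $\kappa$-Borel locale for which $\mathcal B_\kappa(X)$ is the free $\kappa$-Boolean algebra generated by the $(\kappa,\kappa)$-frame $\mathcal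 B^+_\kappa(X)$; an element of $\mathcal B_\kappa(X)$ is called a $\kappa$-Borel set of $X$, and it is positive if it belongs to the image of the canonical map $\mathcal B^+_\kappa(X)\to\mathcal B_\kappa(X)$. The specialization order of a positive $\kappa$-Borel locale $X$ is the universal positive $\kappa$-Borel locale $\le_X$ equipped with maps $\pi_1,\pi_2:{\le_X}\rightrightarrows X$ such that $\pi_1^*\le\pi_2^*$ pointwise on $\mathcal B^+_\kappa(X)$. Passing to underlying $\kappa$-Borel locales, it is an internal partial order on $X$ in $\kappa\mathbf{BorLoc}$. Let $\kappa\mathbf{BorPOLoc}$ be the category of $\kappa$-Borel locales equipped with an internal partial order and of order-preserving $\kappa$-Borel maps, and let $\kappa\mathbf{Bor}^+\mathbf{Loc}\to\kappa\mathbf{BorPOLoc}$ be the forgetful functor that equips the underlying $\kappa$-Borel locale of $X$ with $\le_X$. A $\kappa$-Borel set $B$ of an internally partially ordered $\kappa$-Borel locale $(X,\le)$, with projections $\pi_1,\pi_2:{\le}\rightrightarrows X$, is upper if $\pi_1^*(B)\le\pi_2^*(B)$ in $\mathcal B_\kappa(\le)$. Theorem. For every positive $\kappa$-Borel locale $X$,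 a $\kappa$-Borel set $B\in\mathcal B_\kappa(X)$ is upper with respect to $\le_X$ if and only if it is positive. Moreover, the forgetful functor $\kappa\mathbf{Bor}^+\mathbf{Loc}\to\kappa\mathbf{BorPOLoc}$ is full and faithful. -/

import Mathlib

open CategoryTheory Cardinal

universe u v

namespace KBorel

/-! ### `(κ, κ)`-frames -/

/-- A bounded distributive lattice is a `(κ, κ)`-frame if it has joins and meets of all subsets of
size `< κ`, over which binary meets and binary joins distribute, respectively. -/
structure IsKKFrame (κ : Cardinal.{u}) (A : Type u) [DistribLattice A] [BoundedOrder A] :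
    Prop where
  exists_isLUB : ∀ S : Set A, #S < κ → ∃ s, IsLUB S s
  exists_isGLB : ∀ S : Set A, #S < κ → ∃ s, IsGLB S s
  inf_isLUB : ∀ S : Set A, #S < κ → ∀ s, IsLUB S s → ∀ a, IsLUB ((fun x => a ⊓ x) '' S) (a ⊓ s)
  sup_isGLB : ∀ S : Set A, #S < κ → ∀ s, IsGLB S s → ∀ a, IsGLB ((fun x => a ⊔ x) '' S) (a ⊔ s)

/-- Bundled `(κ, κ)`-frames. -/
structure KKFrm (κ : Cardinal.{u}) : Type (u + 1) where
  carrier : Type u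
  [lattice : DistribLattice carrier]
  [bounded : BoundedOrder carrier]
  isKKFrame : IsKKFrame κ carrier

namespace KKFrm

variable {κ : Cardinal.{u}}

instance : CoeSort (KKFrm κ) (Type u) := ⟨KKFrm.carrier⟩

instance (A : KKFrm κ) : DistribLattice A := A.lattice

instance (A : KKFrm κ) : BoundedOrder A := A.bounded

/-- Homomorphisms of `(κ, κ)`-frames: maps preserving finite and `κ`-ary joins and meets. -/
@[ext]
structure Hom (A B : KKFrm κ) : Type u where
  toFun : A → B
  map_bot : toFun ⊥ = ⊥
  map_top : toFun ⊤ = ⊤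
  map_sup : ∀ a b, toFun (a ⊔ b) = toFun a ⊔ toFun b
  map_inf : ∀ a b, toFun (a ⊓ b) = toFun a ⊓ toFun b
  map_isLUB : ∀ S : Set A, #S < κ → ∀ s, IsLUB S s → IsLUB (toFun '' S) (toFun s)
  map_isGLB : ∀ S : Set A, #S < κ → ∀ s, IsGLB S s → IsGLB (toFun '' S) (toFun s)

instance (A B : KKFrm κ) : CoeFun (Hom A B) (fun _ => A → B) := ⟨Hom.toFun⟩

/-- The identity homomorphism. -/
def Hom.id (A : KKFrm κ) : Hom A A where
  toFun a := a
  map_bot := rfl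
  map_top := rfl
  map_sup _ _ := rfl
  map_inf _ _ := rfl
  map_isLUB S _ s h := by simpa using h
  map_isGLB S _ s h := by simpa using h

/-- Composition of homomorphisms. -/
def Hom.comp {A B C : KKFrm κ} (f : Hom A B) (g : Hom B C) : Hom A C where
  toFun a := g (f a)
  map_bot := by rw [f.map_bot, g.map_bot]
  map_top := by rw [f.map_top, g.map_top]
  map_sup _ _ := by rw [f.map_sup, g.map_sup]
  map_inf _ _ := by rw [f.map_inf, g.map_inf]
  map_isLUB S hS s h := by
    have := g.map_isLUB _ (mk_image_le.trans_lt hS) _ (f.map_isLUB S hS s h)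
    rwa [Set.image_image] at this
  map_isGLB S hS s h := by
    have := g.map_isGLB _ (mk_image_le.trans_lt hS) _ (f.map_isGLB S hS s h)
    rwa [Set.image_image] at this

/-- The category of `(κ, κ)`-frames. -/
instance : Category (KKFrm κ) where
  Hom := Hom
  id := Hom.id
  comp := Hom.comp

instance (A B : KKFrm κ) : CoeFun (A ⟶ B) (fun _ => A → B) := ⟨Hom.toFun⟩

@[simp] theorem id_apply (A : KKFrm κ) (a : A) : (𝟙 A : A ⟶ A) a = a := rfl

@[simp] theorem comp_apply {A B C : KKFrm κ} (f : A ⟶ B) (g : B ⟶ C) (a : A) :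
    (f ≫ g) a = g (f a) := rfl

theorem hom_ext {A B : KKFrm κ} {f g : A ⟶ B} (h : ∀ a, f a = g a) : f = g :=
  Hom.ext (funext h)

theorem hom_mono {A B : KKFrm κ} (f : A ⟶ B) {a b : A} (h : a ≤ b) : f a ≤ f b := by
  rw [← inf_eq_left] at h ⊢
  rw [← f.map_inf, h]

/-- The pointwise partial order on homomorphisms. -/
instance (A B : KKFrm κ) : PartialOrder (A ⟶ B) where
  le f g := ∀ a, f a ≤ g a
  le_refl _ _ := le_rfl
  le_trans _ _ _ h k a := (h a).trans (k a)
  le_antisymm _ _ h k := hom_ext fun a => (h a).antisymm (k a)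

theorem hom_le_def {A B : KKFrm κ} {f g : A ⟶ B} : f ≤ g ↔ ∀ a, f a ≤ g a := Iff.rfl

/-- The join of a `κ`-ary family. -/
noncomputable def lub (A : KKFrm κ) {ι : Type u} (h : #ι < κ) (f : ι → A) : A :=
  (A.isKKFrame.exists_isLUB (Set.range f) (mk_range_le.trans_lt h)).choose

theorem isLUB_lub (A : KKFrm κ) {ι : Type u} (h : #ι < κ) (f : ι → A) :
    IsLUB (Set.range f) (A.lub h f) :=
  (A.isKKFrame.exists_isLUB (Set.range f) (mk_range_le.trans_lt h)).choose_spec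

/-- The meet of a `κ`-ary family. -/
noncomputable def glb (A : KKFrm κ) {ι : Type u} (h : #ι < κ) (f : ι → A) : A :=
  (A.isKKFrame.exists_isGLB (Set.range f) (mk_range_le.trans_lt h)).choose

theorem isGLB_glb (A : KKFrm κ) {ι : Type u} (h : #ι < κ) (f : ι → A) :
    IsGLB (Set.range f) (A.glb h f) :=
  (A.isKKFrame.exists_isGLB (Set.range f) (mk_range_le.trans_lt h)).choose_spec

theorem map_lub {A B : KKFrm κ} (g : A ⟶ B) {ι : Type u} (h : #ι < κ) (f : ι → A) :
    g (A.lub h f) = B.lub h (fun i => g (f i)) := by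
  have := g.map_isLUB _ (mk_range_le.trans_lt h) _ (A.isLUB_lub h f)
  rw [← Set.range_comp] at this
  exact this.unique (B.isLUB_lub h _)

theorem map_glb {A B : KKFrm κ} (g : A ⟶ B) {ι : Type u} (h : #ι < κ) (f : ι → A) :
    g (A.glb h f) = B.glb h (fun i => g (f i)) := by
  have := g.map_isGLB _ (mk_range_le.trans_lt h) _ (A.isGLB_glb h f)
  rw [← Set.range_comp] at this
  exact this.unique (B.isGLB_glb h _)

end KKFrm

/-! ### Algebras presented by generators and conditions -/

/-- Terms over `G` in the language of `(κ, κ)`-frames; the `κ`-ary joins and meets are indexed by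
the subsets of size `< κ` of a fixed set of size `κ`. -/
inductive Term (κ : Cardinal.{u}) (G : Type u) : Type u
  | gen : G → Term κ G
  | bot : Term κ G
  | top : Term κ G
  | sup : Term κ G → Term κ G → Term κ G
  | inf : Term κ G → Term κ G → Term κ G
  | iSup : (S : Set κ.out) → #S < κ → (S → Term κ G) → Term κ G
  | iInf : (S : Set κ.out) → #S < κ → (S → Term κ G) → Term κ G

/-- The value of a term in a `(κ, κ)`-frame under an assignment of the generators. -/
noncomputable def Term.eval {κ : Cardinal.{u}} {G : Type u} (B : KKFrm κ) (v : G → B) :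
    Term κ G → B
  | .gen g => v g
  | .bot => ⊥
  | .top => ⊤
  | .sup s t => s.eval B v ⊔ t.eval B v
  | .inf s t => s.eval B v ⊓ t.eval B v
  | .iSup _ h t => B.lub h (fun i => (t i).eval B v)
  | .iInf _ h t => B.glb h (fun i => (t i).eval B v)

/-- A condition on maps from `G` to `(κ, κ)`-frames. -/
abbrev Cond (κ : Cardinal.{u}) (G : Type u) : Type (u + 1) := (B : KKFrm κ) → (G → B) → Prop

section Presented

variable {κ : Cardinal.{u}} {G : Type u} (M : Cond κ G)

/-- Two terms are identified if they have equal values under all assignments satisfying `M`. -/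
def termSetoid : Setoid (Term κ G) where
  r s t := ∀ (B : KKFrm κ) (f : G → B), M B f → s.eval B f = t.eval B f
  iseqv := ⟨fun _ _ _ _ => rfl, fun h B f hf => (h B f hf).symm,
    fun h k B f hf => (h B f hf).trans (k B f hf)⟩

/-- The underlying set of the `(κ, κ)`-frame presented by the generators `G` subject to `M`. -/
def Pres : Type u := Quotient (termSetoid M)

namespace Pres

variable {M}

/-- The class of a term. -/
def mk (t : Term κ G) : Pres M := Quotient.mk (termSetoid M) t

/-- A representative of a class. -/
noncomputable def rep (q : Pres M) : Term κ G := Quotient.out q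

/-- The value of a class of terms under an assignment satisfying `M`. -/
noncomputable def ev {B : KKFrm κ} (f : G → B) (hf : M B f) (q : Pres M) : B :=
  Quotient.lift (s := termSetoid M) (fun t => t.eval B f) (fun _ _ h => h B f hf) q

@[simp] theorem mk_rep (q : Pres M) : mk (rep q) = q := Quotient.out_eq q

@[simp] theorem ev_mk {B : KKFrm κ} (f : G → B) (hf : M B f) (t : Term κ G) :
    ev f hf (mk t : Pres M) = t.eval B f := rfl

@[simp] theorem eval_rep {B : KKFrm κ} (f : G → B) (hf : M B f) (q : Pres M) :
    (rep q).eval B f = ev f hf q := by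
  rw [← ev_mk f hf, mk_rep]

theorem ext' {p q : Pres M} (h : ∀ (B : KKFrm κ) (f : G → B) (hf : M B f), ev f hf p = ev f hf q) :
    p = q := by
  rw [← mk_rep p, ← mk_rep q]
  refine Quotient.sound (s := termSetoid M) fun B f hf => ?_
  rw [eval_rep f hf, eval_rep f hf, h]

/-- Classes of terms are ordered by the order of their values. -/
instance : PartialOrder (Pres M) where
  le p q := ∀ (B : KKFrm κ) (f : G → B) (hf : M B f), ev f hf p ≤ ev f hf q
  le_refl _ _ _ _ := le_rfl
  le_trans _ _ _ h k B f hf := (h B f hf).trans (k B f hf)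
  le_antisymm _ _ h k := ext' fun B f hf => (h B f hf).antisymm (k B f hf)

theorem le_def {p q : Pres M} :
    p ≤ q ↔ ∀ (B : KKFrm κ) (f : G → B) (hf : M B f), ev f hf p ≤ ev f hf q := Iff.rfl

noncomputable instance : Max (Pres M) := ⟨fun p q => mk (.sup (rep p) (rep q))⟩

noncomputable instance : Min (Pres M) := ⟨fun p q => mk (.inf (rep p) (rep q))⟩

section
variable {B : KKFrm κ} (f : G → B) (hf : M B f)

@[simp] theorem ev_sup (p q : Pres M) : ev f hf (p ⊔ q) = ev f hf p ⊔ ev f hf q := by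
  change (Term.sup (rep p) (rep q)).eval B f = _
  simp [Term.eval, eval_rep f hf]

@[simp] theorem ev_inf (p q : Pres M) : ev f hf (p ⊓ q) = ev f hf p ⊓ ev f hf q := by
  change (Term.inf (rep p) (rep q)).eval B f = _
  simp [Term.eval, eval_rep f hf]

end

noncomputable instance : DistribLattice (Pres M) where
  sup := max
  inf := min
  le_sup_left p q B f hf := by simp
  le_sup_right p q B f hf := by simp
  sup_le p q r h k B f hf := by simpa using ⟨h B f hf, k B f hf⟩
  inf_le_left p q B f hf := by simp
  inf_le_right p q B f hf := by simp
  le_inf p q r h k B f hf := by simpa using ⟨h B f hf, k B f hf⟩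
  le_sup_inf p q r B f hf := by
    simp only [ev_sup, ev_inf]
    exact le_sup_inf

noncomputable instance : BoundedOrder (Pres M) where
  bot := mk .bot
  top := mk .top
  bot_le p B f hf := by simp [Term.eval]
  le_top p B f hf := by simp [Term.eval]

theorem exists_index {X : Type u} (S : Set X) (hS : #S < κ) :
    ∃ T : Set κ.out, #T < κ ∧ Nonempty (T ≃ S) := by
  have h : #S ≤ #κ.out := by rw [mk_out]; exact hS.le
  obtain ⟨e⟩ := h
  refine ⟨Set.range e, ?_, ⟨(Equiv.ofInjective e e.injective).symm⟩⟩
  rwa [mk_range_eq e e.injective]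

theorem exists_join (S : Set (Pres M)) (hS : #S < κ) :
    ∃ s : Pres M, ∀ (B : KKFrm κ) (f : G → B) (hf : M B f), IsLUB (ev f hf '' S) (ev f hf s) := by
  obtain ⟨T, hT, ⟨e⟩⟩ := exists_index S hS
  refine ⟨mk (.iSup T hT fun i => rep (e i).1), fun B f hf => ?_⟩
  have := B.isLUB_lub hT (fun i => (rep (e i).1).eval B f)
  have hr : Set.range (fun i => (rep (e i).1).eval B f) = ev f hf '' S := by
    ext x
    constructor
    · rintro ⟨i, rfl⟩
      exact ⟨_, (e i).2, (eval_rep f hf _).symm⟩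
    · rintro ⟨q, hq, rfl⟩
      exact ⟨e.symm ⟨q, hq⟩, by simp [eval_rep f hf]⟩
  rwa [hr] at this

theorem exists_meet (S : Set (Pres M)) (hS : #S < κ) :
    ∃ s : Pres M, ∀ (B : KKFrm κ) (f : G → B) (hf : M B f), IsGLB (ev f hf '' S) (ev f hf s) := by
  obtain ⟨T, hT, ⟨e⟩⟩ := exists_index S hS
  refine ⟨mk (.iInf T hT fun i => rep (e i).1), fun B f hf => ?_⟩
  have := B.isGLB_glb hT (fun i => (rep (e i).1).eval B f)
  have hr : Set.range (fun i => (rep (e i).1).eval B f) = ev f hf '' S := by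
    ext x
    constructor
    · rintro ⟨i, rfl⟩
      exact ⟨_, (e i).2, (eval_rep f hf _).symm⟩
    · rintro ⟨q, hq, rfl⟩
      exact ⟨e.symm ⟨q, hq⟩, by simp [eval_rep f hf]⟩
  rwa [hr] at this

theorem isLUB_of_ev {S : Set (Pres M)} {s : Pres M}
    (h : ∀ (B : KKFrm κ) (f : G → B) (hf : M B f), IsLUB (ev f hf '' S) (ev f hf s)) :
    IsLUB S s :=
  ⟨fun _ hp B f hf => (h B f hf).1 ⟨_, hp, rfl⟩, fun q hq B f hf => (h B f hf).2 (by
    rintro _ ⟨p, hp, rfl⟩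
    exact hq hp B f hf)⟩

theorem isGLB_of_ev {S : Set (Pres M)} {s : Pres M}
    (h : ∀ (B : KKFrm κ) (f : G → B) (hf : M B f), IsGLB (ev f hf '' S) (ev f hf s)) :
    IsGLB S s :=
  ⟨fun _ hp B f hf => (h B f hf).1 ⟨_, hp, rfl⟩, fun q hq B f hf => (h B f hf).2 (by
    rintro _ ⟨p, hp, rfl⟩
    exact hq hp B f hf)⟩

theorem ev_isLUB {S : Set (Pres M)} (hS : #S < κ) {s : Pres M} (h : IsLUB S s)
    {B : KKFrm κ} (f : G → B) (hf : M B f) : IsLUB (ev f hf '' S) (ev f hf s) := by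
  obtain ⟨t, ht⟩ := exists_join S hS
  rw [h.unique (isLUB_of_ev ht)]
  exact ht B f hf

theorem ev_isGLB {S : Set (Pres M)} (hS : #S < κ) {s : Pres M} (h : IsGLB S s)
    {B : KKFrm κ} (f : G → B) (hf : M B f) : IsGLB (ev f hf '' S) (ev f hf s) := by
  obtain ⟨t, ht⟩ := exists_meet S hS
  rw [h.unique (isGLB_of_ev ht)]
  exact ht B f hf

theorem isKKFrame : IsKKFrame κ (Pres M) where
  exists_isLUB S hS := (exists_join S hS).imp fun _ h => isLUB_of_ev h
  exists_isGLB S hS := (exists_meet S hS).imp fun _ h => isGLB_of_ev h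
  inf_isLUB S hS s h a := isLUB_of_ev fun B f hf => by
    have := B.isKKFrame.inf_isLUB _ (mk_image_le.trans_lt hS) _ (ev_isLUB hS h f hf) (ev f hf a)
    simpa only [Set.image_image, ev_inf] using this
  sup_isGLB S hS s h a := isGLB_of_ev fun B f hf => by
    have := B.isKKFrame.sup_isGLB _ (mk_image_le.trans_lt hS) _ (ev_isGLB hS h f hf) (ev f hf a)
    simpa only [Set.image_image, ev_sup] using this

end Pres

/-- The `(κ, κ)`-frame presented by the generators `G` subject to the condition `M`. -/
noncomputable def presented : KKFrm κ where
  carrier := Pres M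
  isKKFrame := Pres.isKKFrame

/-- The generators of `presented M`. -/
def presGen (g : G) : presented M := Pres.mk (.gen g)

variable {M}

/-- The homomorphism out of `presented M` induced by a map of generators satisfying `M`. -/
noncomputable def presLift {B : KKFrm κ} (f : G → B) (hf : M B f) : presented M ⟶ B where
  toFun := Pres.ev f hf
  map_bot := rfl
  map_top := rfl
  map_sup := Pres.ev_sup f hf
  map_inf := Pres.ev_inf f hf
  map_isLUB _ hS _ h := Pres.ev_isLUB hS h f hf
  map_isGLB _ hS _ h := Pres.ev_isGLB hS h f hf

@[simp] theorem presLift_gen {B : KKFrm κ} (f : G → B) (hf : M B f) (g : G) :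
    presLift f hf (presGen M g) = f g := rfl

theorem pres_le_iff {p q : presented M} :
    p ≤ q ↔ ∀ (B : KKFrm κ) (f : G → B) (hf : M B f), presLift f hf p ≤ presLift f hf q := Iff.rfl

theorem pres_ext {p q : presented M}
    (h : ∀ (B : KKFrm κ) (f : G → B) (hf : M B f), presLift f hf p = presLift f hf q) : p = q :=
  Pres.ext' h

theorem pres_isLUB {S : Set (presented M)} {s : presented M}
    (h : ∀ (B : KKFrm κ) (f : G → B) (hf : M B f),
      IsLUB (presLift f hf '' S) (presLift f hf s)) : IsLUB S s :=
  Pres.isLUB_of_ev h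

theorem pres_isGLB {S : Set (presented M)} {s : presented M}
    (h : ∀ (B : KKFrm κ) (f : G → B) (hf : M B f),
      IsGLB (presLift f hf '' S) (presLift f hf s)) : IsGLB S s :=
  Pres.isGLB_of_ev h

/-- Induction over the elements of `presented M`. -/
theorem pres_induction {P : presented M → Prop} (hgen : ∀ g, P (presGen M g))
    (hbot : P ⊥) (htop : P ⊤) (hsup : ∀ a b, P a → P b → P (a ⊔ b))
    (hinf : ∀ a b, P a → P b → P (a ⊓ b))
    (hlub : ∀ (ι : Type u) (h : #ι < κ) (f : ι → presented M), (∀ i, P (f i)) →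
      P ((presented M).lub h f))
    (hglb : ∀ (ι : Type u) (h : #ι < κ) (f : ι → presented M), (∀ i, P (f i)) →
      P ((presented M).glb h f)) (a : presented M) : P a := by
  have key : ∀ t : Term κ G, P (Pres.mk t : Pres M) := by
    intro t
    induction t with
    | gen g => exact hgen g
    | bot => exact hbot
    | top => exact htop
    | sup s t hs ht =>
      have e : (Pres.mk (.sup s t) : presented M) = Pres.mk s ⊔ Pres.mk t :=
        pres_ext fun B f hf => ((presLift f hf).map_sup (Pres.mk s) (Pres.mk t)).symm
      exact e ▸ hsup _ _ hs ht
    | inf s t hs ht =>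
      have e : (Pres.mk (.inf s t) : presented M) = Pres.mk s ⊓ Pres.mk t :=
        pres_ext fun B f hf => ((presLift f hf).map_inf (Pres.mk s) (Pres.mk t)).symm
      exact e ▸ hinf _ _ hs ht
    | iSup S hS t ih =>
      have e : (Pres.mk (.iSup S hS t) : presented M) =
          (presented M).lub hS (fun i => (Pres.mk (t i) : Pres M)) :=
        pres_ext fun B f hf =>
          (KKFrm.map_lub (presLift f hf) hS (fun i => (Pres.mk (t i) : Pres M))).symm
      exact e ▸ hlub S hS _ ih
    | iInf S hS t ih =>
      have e : (Pres.mk (.iInf S hS t) : presented M) =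
          (presented M).glb hS (fun i => (Pres.mk (t i) : Pres M)) :=
        pres_ext fun B f hf =>
          (KKFrm.map_glb (presLift f hf) hS (fun i => (Pres.mk (t i) : Pres M))).symm
      exact e ▸ hglb S hS _ ih
  rw [← Pres.mk_rep a]
  exact key _

theorem pres_hom_ext {B : KKFrm κ} {f g : presented M ⟶ B}
    (h : ∀ x, f (presGen M x) = g (presGen M x)) : f = g := by
  refine KKFrm.hom_ext fun a => ?_
  induction a using pres_induction with
  | hgen x => exact h x
  | hbot => rw [f.map_bot, g.map_bot]
  | htop => rw [f.map_top, g.map_top]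
  | hsup a b ha hb => rw [f.map_sup, g.map_sup, ha, hb]
  | hinf a b ha hb => rw [f.map_inf, g.map_inf, ha, hb]
  | hlub ι hι t ht => rw [KKFrm.map_lub, KKFrm.map_lub]; simp only [ht]
  | hglb ι hι t ht => rw [KKFrm.map_glb, KKFrm.map_glb]; simp only [ht]

/-- If all `f` satisfying `M` restrict along `g` to homomorphisms on `A`, then `g` induces a
homomorphism from `A` to `presented M`. -/
def presHom {A : KKFrm κ} (g : A → G)
    (H : ∀ (B : KKFrm κ) (f : G → B), M B f → ∃ h : A ⟶ B, ∀ a, f (g a) = h a) :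
    A ⟶ presented M where
  toFun a := presGen M (g a)
  map_bot := pres_ext fun B f hf => by
    obtain ⟨h, hh⟩ := H B f hf
    rw [presLift_gen, hh, h.map_bot, (presLift f hf).map_bot]
  map_top := pres_ext fun B f hf => by
    obtain ⟨h, hh⟩ := H B f hf
    rw [presLift_gen, hh, h.map_top, (presLift f hf).map_top]
  map_sup a b := pres_ext fun B f hf => by
    obtain ⟨h, hh⟩ := H B f hf
    simp only [presLift_gen, hh, h.map_sup, (presLift f hf).map_sup]
  map_inf a b := pres_ext fun B f hf => by
    obtain ⟨h, hh⟩ := H B f hf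
    simp only [presLift_gen, hh, h.map_inf, (presLift f hf).map_inf]
  map_isLUB S hS s hs := pres_isLUB fun B f hf => by
    obtain ⟨h, hh⟩ := H B f hf
    simpa only [Set.image_image, presLift_gen, hh] using h.map_isLUB S hS s hs
  map_isGLB S hS s hs := pres_isGLB fun B f hf => by
    obtain ⟨h, hh⟩ := H B f hf
    simpa only [Set.image_image, presLift_gen, hh] using h.map_isGLB S hS s hs

end Presented

/-! ### `κ`-Boolean algebras -/

section Boolean

variable {κ : Cardinal.{u}}

/-- A Boolean algebra with `κ`-ary joins is a `(κ, κ)`-frame. -/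
theorem IsKKFrame.of_booleanAlgebra {A : Type u} [BooleanAlgebra A]
    (h : ∀ S : Set A, #S < κ → ∃ s, IsLUB S s) : IsKKFrame κ A where
  exists_isLUB := h
  exists_isGLB S hS := by
    obtain ⟨s, hs⟩ := h (compl '' S) (mk_image_le.trans_lt hS)
    refine ⟨sᶜ, fun a ha => ?_, fun b hb => ?_⟩
    · exact compl_le_of_compl_le (hs.1 ⟨a, ha, rfl⟩)
    · refine le_compl_comm.1 (hs.2 ?_)
      rintro _ ⟨a, ha, rfl⟩
      exact compl_le_compl (hb ha)
  inf_isLUB S _ s hs a := by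
    refine ⟨?_, fun b hb => ?_⟩
    · rintro _ ⟨x, hx, rfl⟩
      exact inf_le_inf_left a (hs.1 hx)
    · rw [← le_himp_iff']
      exact hs.2 fun x hx => le_himp_iff'.2 (hb ⟨x, hx, rfl⟩)
  sup_isGLB S _ s hs a := by
    refine ⟨?_, fun b hb => ?_⟩
    · rintro _ ⟨x, hx, rfl⟩
      exact sup_le_sup_left (hs.1 hx) a
    · rw [← sdiff_le_iff]
      exact hs.2 fun x hx => sdiff_le_iff.2 (hb ⟨x, hx, rfl⟩)

/-- The category of `κ`-Boolean algebras, as the full subcategory of the `(κ, κ)`-frames in which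
every element has a complement. (A `κ`-frame with complements is automatically a `(κ, κ)`-frame,
and homomorphisms of `κ`-frames between such automatically preserve complements and `κ`-ary
meets.) -/
abbrev KBool (κ : Cardinal.{u}) : Type (u + 1) :=
  ObjectProperty.FullSubcategory (fun A : KKFrm κ => ComplementedLattice A)

theorem KKFrm.isCompl_lub_glb (A : KKFrm κ) {ι : Type u} (h : #ι < κ) {f g : ι → A}
    (hfg : ∀ i, IsCompl (f i) (g i)) : IsCompl (A.lub h f) (A.glb h g) := by
  constructor
  · rw [disjoint_iff_inf_le, inf_comm]
    refine (A.isKKFrame.inf_isLUB _ (mk_range_le.trans_lt h) _ (A.isLUB_lub h f) _).2 ?_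
    rintro _ ⟨_, ⟨i, rfl⟩, rfl⟩
    have : A.glb h g ≤ g i := (A.isGLB_glb h g).1 ⟨i, rfl⟩
    exact (inf_le_inf_right _ this).trans (hfg i).symm.disjoint.le_bot
  · rw [codisjoint_iff_le_sup]
    refine (A.isKKFrame.sup_isGLB _ (mk_range_le.trans_lt h) _ (A.isGLB_glb h g) _).2 ?_
    rintro _ ⟨_, ⟨i, rfl⟩, rfl⟩
    have : f i ≤ A.lub h f := (A.isLUB_lub h f).1 ⟨i, rfl⟩
    exact (hfg i).codisjoint.top_le.trans (sup_le_sup_right this _)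

theorem KKFrm.map_isCompl {A B : KKFrm κ} (f : A ⟶ B) {a b : A} (h : IsCompl a b) :
    IsCompl (f a) (f b) := by
  constructor
  · rw [disjoint_iff, ← f.map_inf, h.inf_eq_bot, f.map_bot]
  · rw [codisjoint_iff, ← f.map_sup, h.sup_eq_top, f.map_top]

/-- The condition presenting the free `κ`-Boolean algebra generated by a `(κ, κ)`-frame `A`: the
generators are the elements of `A`, subject to all relations that hold in `A`, together with a
complement of each of them. -/
def boolCond (A : KKFrm κ) : Cond κ (A ⊕ A) := fun B f =>
  (∃ h : A ⟶ B, ∀ a, f (.inl a) = h a) ∧ ∀ a, IsCompl (f (.inl a)) (f (.inr a))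

/-- The free `κ`-Boolean algebra generated by `A`, as a `(κ, κ)`-frame. -/
noncomputable def boolFrm (A : KKFrm κ) : KKFrm κ := presented (boolCond A)

/-- The canonical homomorphism from `A` to the free `κ`-Boolean algebra it generates. -/
def boolUnit (A : KKFrm κ) : A ⟶ boolFrm A :=
  presHom (M := boolCond A) .inl fun _ _ hf => hf.1

theorem boolFrm_isCompl (A : KKFrm κ) (a : A) :
    IsCompl (presGen (boolCond A) (.inl a)) (presGen (boolCond A) (.inr a)) := by
  constructor
  · rw [disjoint_iff]
    refine pres_ext fun B f hf => ?_
    refine ((presLift f hf).map_inf _ _).trans ?_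
    exact (hf.2 a).inf_eq_bot.trans (presLift f hf).map_bot.symm
  · rw [codisjoint_iff]
    refine pres_ext fun B f hf => ?_
    refine ((presLift f hf).map_sup _ _).trans ?_
    exact (hf.2 a).sup_eq_top.trans (presLift f hf).map_top.symm

theorem boolFrm_complemented (A : KKFrm κ) : ComplementedLattice (boolFrm A) := by
  refine ⟨fun a => ?_⟩
  induction a using pres_induction with
  | hgen x =>
    rcases x with a | a
    · exact ⟨_, boolFrm_isCompl A a⟩
    · exact ⟨_, (boolFrm_isCompl A a).symm⟩
  | hbot => exact ⟨⊤, isCompl_bot_top⟩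
  | htop => exact ⟨⊥, isCompl_top_bot⟩
  | hsup a b ha hb =>
    obtain ⟨c, hc⟩ := ha
    obtain ⟨d, hd⟩ := hb
    exact ⟨c ⊓ d, hc.sup_inf hd⟩
  | hinf a b ha hb =>
    obtain ⟨c, hc⟩ := ha
    obtain ⟨d, hd⟩ := hb
    exact ⟨c ⊔ d, hc.inf_sup hd⟩
  | hlub ι h f ih =>
    choose g hg using ih
    exact ⟨_, (boolFrm A).isCompl_lub_glb h hg⟩
  | hglb ι h f ih =>
    choose g hg using ih
    exact ⟨_, ((boolFrm A).isCompl_lub_glb h fun i => (hg i).symm).symm⟩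

/-- The extension of a homomorphism to a `κ`-Boolean algebra along `boolUnit`. -/
noncomputable def boolLift {A B : KKFrm κ} [ComplementedLattice B] (f : A ⟶ B) :
    boolFrm A ⟶ B :=
  presLift (M := boolCond A)
    (Sum.elim (fun a => f a) (fun a => (exists_isCompl (f a)).choose))
    ⟨⟨f, fun _ => rfl⟩, fun a => (exists_isCompl (f a)).choose_spec⟩

theorem boolUnit_lift {A B : KKFrm κ} [ComplementedLattice B] (f : A ⟶ B) :
    boolUnit A ≫ boolLift f = f := rfl

theorem bool_hom_ext {A B : KKFrm κ} {f g : boolFrm A ⟶ B}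
    (h : boolUnit A ≫ f = boolUnit A ≫ g) : f = g := by
  have h' : ∀ a, f (presGen (boolCond A) (.inl a)) = g (presGen (boolCond A) (.inl a)) :=
    fun a => congrArg (fun k : A ⟶ B => k a) h
  refine pres_hom_ext fun x => ?_
  rcases x with a | a
  · exact h' a
  · have hf := KKFrm.map_isCompl f (boolFrm_isCompl A a)
    have hg := KKFrm.map_isCompl g (boolFrm_isCompl A a)
    rw [h'] at hf
    exact hf.right_unique hg

/-- The universal property of the free `κ`-Boolean algebra generated by a `(κ, κ)`-frame. -/
noncomputable def boolEquiv (A : KKFrm κ) (B : KBool κ) :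
    ((⟨boolFrm A, boolFrm_complemented A⟩ : KBool κ) ⟶ B) ≃
      (A ⟶ (ObjectProperty.ι (fun A : KKFrm κ => ComplementedLattice A)).obj B) where
  toFun f := boolUnit A ≫ f.hom
  invFun f := ObjectProperty.homMk (@boolLift _ A B.obj B.property f)
  left_inv _ := ObjectProperty.hom_ext _ (bool_hom_ext (@boolUnit_lift _ _ _ B.property _))
  right_inv f := @boolUnit_lift _ A B.obj B.property f

/-- The free functor from `(κ, κ)`-frames to `κ`-Boolean algebras, left adjoint to the inclusion. -/
noncomputable def freeBool (κ : Cardinal.{u}) : KKFrm κ ⥤ KBool κ :=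
  Adjunction.leftAdjointOfEquiv (G := ObjectProperty.ι (fun A : KKFrm κ => ComplementedLattice A))
    boolEquiv (fun _ _ _ _ _ => rfl)

/-- The adjunction between `freeBool κ` and the inclusion. -/
noncomputable def freeBoolAdj (κ : Cardinal.{u}) :
    freeBool κ ⊣ ObjectProperty.ι (fun A : KKFrm κ => ComplementedLattice A) :=
  Adjunction.adjunctionOfEquivLeft _ _

/-- The canonical homomorphism `A ⟶ ⟨A⟩`, i.e. the unit of `freeBoolAdj κ`. -/
noncomputable def freeUnit (A : KKFrm κ) : A ⟶ ((freeBool κ).obj A).obj := boolUnit A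

theorem freeUnit_eq (A : KKFrm κ) : freeUnit A = (freeBoolAdj κ).unit.app A :=
  (Category.comp_id (freeUnit A)).symm

/-- The extension of a homomorphism to a `κ`-Boolean algebra along `freeUnit`. -/
noncomputable def freeLift {A : KKFrm κ} {B : KBool κ} (f : A ⟶ B.obj) : (freeBool κ).obj A ⟶ B :=
  (boolEquiv A B).symm f

theorem freeUnit_lift {A : KKFrm κ} {B : KBool κ} (f : A ⟶ B.obj) :
    freeUnit A ≫ (freeLift f).hom = f :=
  (boolEquiv A B).apply_symm_apply f

theorem free_hom_ext {A : KKFrm κ} {B : KBool κ} {f g : (freeBool κ).obj A ⟶ B}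
    (h : freeUnit A ≫ f.hom = freeUnit A ≫ g.hom) : f = g :=
  (boolEquiv A B).injective h

theorem freeUnit_map {A B : KKFrm κ} (f : A ⟶ B) :
    freeUnit A ≫ ((freeBool κ).map f).hom = f ≫ freeUnit B :=
  freeUnit_lift (B := (freeBool κ).obj B) (f ≫ freeUnit B)

theorem freeUnit_map_assoc {A B C : KKFrm κ} (f : A ⟶ B) (g : ((freeBool κ).obj B).obj ⟶ C) :
    freeUnit A ≫ ((freeBool κ).map f).hom ≫ g = f ≫ freeUnit B ≫ g := by
  rw [← Category.assoc, freeUnit_map, Category.assoc]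

end Boolean

/-! ### The specialization order -/

section SpecOrder

variable {κ : Cardinal.{u}}

/-- The condition presenting the universal `(κ, κ)`-frame equipped with a pair of homomorphisms
from `A`, the first of which is below the second. -/
def specCond (A : KKFrm κ) : Cond κ (A ⊕ A) := fun B f =>
  ∃ h k : A ⟶ B, h ≤ k ∧ (∀ a, f (.inl a) = h a) ∧ ∀ a, f (.inr a) = k a

/-- The copower of `A` by the two-element chain: the `(κ, κ)`-frame dual to the order on the
positive `κ`-Borel locale dual to `A`. -/
noncomputable def specFrm (A : KKFrm κ) : KKFrm κ := presented (specCond A)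

/-- The first coprojection, dual to the first projection from the order. -/
def specFst (A : KKFrm κ) : A ⟶ specFrm A :=
  presHom (M := specCond A) .inl fun _ _ ⟨h, _, _, hh, _⟩ => ⟨h, hh⟩

/-- The second coprojection, dual to the second projection from the order. -/
def specSnd (A : KKFrm κ) : A ⟶ specFrm A :=
  presHom (M := specCond A) .inr fun _ _ ⟨_, k, _, _, hk⟩ => ⟨k, hk⟩

theorem specFst_le_specSnd (A : KKFrm κ) : specFst A ≤ specSnd A := fun a B f hf => by
  obtain ⟨h, k, hk, h1, h2⟩ := id hf
  change f (.inl a) ≤ f (.inr a)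
  rw [h1, h2]
  exact hk a

/-- The homomorphism out of `specFrm A` induced by homomorphisms `f ≤ g`. -/
noncomputable def specLift {A B : KKFrm κ} (f g : A ⟶ B) (h : f ≤ g) : specFrm A ⟶ B :=
  presLift (M := specCond A) (Sum.elim (fun a => f a) (fun a => g a))
    ⟨f, g, h, fun _ => rfl, fun _ => rfl⟩

theorem specFst_lift {A B : KKFrm κ} (f g : A ⟶ B) (h : f ≤ g) :
    specFst A ≫ specLift f g h = f := rfl

theorem specSnd_lift {A B : KKFrm κ} (f g : A ⟶ B) (h : f ≤ g) :
    specSnd A ≫ specLift f g h = g := rfl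

theorem spec_hom_ext {A B : KKFrm κ} {f g : specFrm A ⟶ B}
    (h1 : specFst A ≫ f = specFst A ≫ g) (h2 : specSnd A ≫ f = specSnd A ≫ g) : f = g := by
  refine pres_hom_ext fun x => ?_
  rcases x with a | a
  · exact congrArg (fun k : A ⟶ B => k a) h1
  · exact congrArg (fun k : A ⟶ B => k a) h2

theorem spec_bool_hom_ext {A : KKFrm κ} {B : KBool κ}
    {f g : (freeBool κ).obj (specFrm A) ⟶ B}
    (h1 : (freeBool κ).map (specFst A) ≫ f = (freeBool κ).map (specFst A) ≫ g)
    (h2 : (freeBool κ).map (specSnd A) ≫ f = (freeBool κ).map (specSnd A) ≫ g) : f = g := by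
  refine free_hom_ext (spec_hom_ext ?_ ?_)
  · have h := congrArg (fun k => freeUnit A ≫ k.hom) h1
    simpa only [ObjectProperty.FullSubcategory.comp_hom, freeUnit_map_assoc] using h
  · have h := congrArg (fun k => freeUnit A ≫ k.hom) h2
    simpa only [ObjectProperty.FullSubcategory.comp_hom, freeUnit_map_assoc] using h

theorem spec_comp_le {A B C : KKFrm κ} (f : B ⟶ A) (g : specFrm A ⟶ C) :
    f ≫ specFst A ≫ g ≤ f ≫ specSnd A ≫ g :=
  fun b => KKFrm.hom_mono g (specFst_le_specSnd A (f b))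

/-- A pair of `κ`-Borel maps factors through the order iff the corresponding pair of homomorphisms
on positive `κ`-Borel sets is ordered pointwise. -/
theorem spec_factor_iff {A : KKFrm κ} {B : KBool κ} (f g : (freeBool κ).obj A ⟶ B) :
    (∃ h : (freeBool κ).obj (specFrm A) ⟶ B,
      (freeBool κ).map (specFst A) ≫ h = f ∧ (freeBool κ).map (specSnd A) ≫ h = g) ↔
      freeUnit A ≫ f.hom ≤ freeUnit A ≫ g.hom := by
  constructor
  · rintro ⟨h, rfl, rfl⟩
    simp only [ObjectProperty.FullSubcategory.comp_hom, freeUnit_map_assoc]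
    exact spec_comp_le (𝟙 A) (freeUnit _ ≫ h.hom)
  · intro h
    refine ⟨freeLift (specLift _ _ h), ?_, ?_⟩ <;>
    · refine free_hom_ext ?_
      simp only [ObjectProperty.FullSubcategory.comp_hom, freeUnit_map_assoc, freeUnit_lift]
      rfl

end SpecOrder

/-! ### Internal partial orders -/

section Internal

/-- An internal partial order on an object `X` of a category: a relation on `X` (a jointly monic
pair of morphisms to `X`, i.e. a subobject of `X × X` when that exists) which is reflexive,
transitive and antisymmetric on generalized elements. -/
structure InternalPartialOrder {C : Type u} [Category.{v} C] (X : C) where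
  rel : C
  fst : rel ⟶ X
  snd : rel ⟶ X
  jointly_mono : ∀ {Z : C} (h k : Z ⟶ rel), h ≫ fst = k ≫ fst → h ≫ snd = k ≫ snd → h = k
  refl : ∀ {Z : C} (a : Z ⟶ X), ∃ h : Z ⟶ rel, h ≫ fst = a ∧ h ≫ snd = a
  trans : ∀ {Z : C} (a b c : Z ⟶ X), (∃ h : Z ⟶ rel, h ≫ fst = a ∧ h ≫ snd = b) →
    (∃ h : Z ⟶ rel, h ≫ fst = b ∧ h ≫ snd = c) → ∃ h : Z ⟶ rel, h ≫ fst = a ∧ h ≫ snd = c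
  antisymm : ∀ {Z : C} (a b : Z ⟶ X), (∃ h : Z ⟶ rel, h ≫ fst = a ∧ h ≫ snd = b) →
    (∃ h : Z ⟶ rel, h ≫ fst = b ∧ h ≫ snd = a) → a = b

/-- Objects of `C` equipped with an internal partial order. -/
structure POObj (C : Type u) [Category.{v} C] : Type (max u v) where
  carrier : C
  order : InternalPartialOrder carrier

/-- Internally order-preserving morphisms. -/
@[ext]
structure POObj.Hom {C : Type u} [Category.{v} C] (X Y : POObj C) : Type v where
  hom : X.carrier ⟶ Y.carrier
  mono : ∃ h : X.order.rel ⟶ Y.order.rel,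
    h ≫ Y.order.fst = X.order.fst ≫ hom ∧ h ≫ Y.order.snd = X.order.snd ≫ hom

/-- The category of internally partially ordered objects of `C`. -/
instance {C : Type u} [Category.{v} C] : Category (POObj C) where
  Hom := POObj.Hom
  id X := ⟨𝟙 _, 𝟙 _, by simp, by simp⟩
  comp {X Y Z} f g := ⟨f.hom ≫ g.hom, by
    obtain ⟨h, h1, h2⟩ := f.mono
    obtain ⟨k, k1, k2⟩ := g.mono
    exact ⟨h ≫ k, by rw [Category.assoc, k1, reassoc_of% h1],
      by rw [Category.assoc, k2, reassoc_of% h2]⟩⟩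
  id_comp _ := POObj.Hom.ext (Category.id_comp _)
  comp_id _ := POObj.Hom.ext (Category.comp_id _)
  assoc _ _ _ := POObj.Hom.ext (Category.assoc _ _ _)

end Internal

/-! ### Positive `κ`-Borel locales and `κ`-Borel polocales -/

section Locales

variable {κ : Cardinal.{u}}

/-- The category of positive `κ`-Borel locales. -/
abbrev BorPlusLoc (κ : Cardinal.{u}) : Type (u + 1) := (KKFrm κ)ᵒᵖ

/-- The category of `κ`-Borel locales. -/
abbrev BorLoc (κ : Cardinal.{u}) : Type (u + 1) := (KBool κ)ᵒᵖ

/-- The category of `κ`-Borel polocales. -/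
abbrev BorPOLoc (κ : Cardinal.{u}) : Type (u + 1) := POObj (BorLoc κ)

/-- The `κ`-Borel sets of a `κ`-Borel locale. -/
abbrev BorelSet (X : BorLoc κ) : Type u := X.unop.obj

/-- The preimage of a `κ`-Borel set under a `κ`-Borel map. -/
abbrev preimage {X Y : BorLoc κ} (f : X ⟶ Y) (B : BorelSet Y) : BorelSet X := f.unop.hom B

/-- The `κ`-Borel locale underlying a positive `κ`-Borel locale. -/
noncomputable abbrev forgetBor (κ : Cardinal.{u}) : BorPlusLoc κ ⥤ BorLoc κ := (freeBool κ).op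

/-- The order on a positive `κ`-Borel locale `X`: the universal positive `κ`-Borel locale equipped
with a pair of maps to `X`, the first of which is below the second. -/
noncomputable abbrev specLoc (X : BorPlusLoc κ) : BorPlusLoc κ := Opposite.op (specFrm X.unop)

theorem specLoc_rel_iff {X : BorPlusLoc κ} {Z : BorLoc κ} (a b : Z ⟶ (forgetBor κ).obj X) :
    (∃ h : Z ⟶ (forgetBor κ).obj (specLoc X),
      h ≫ (forgetBor κ).map (specFst X.unop).op = a ∧
      h ≫ (forgetBor κ).map (specSnd X.unop).op = b) ↔
      freeUnit X.unop ≫ a.unop.hom ≤ freeUnit X.unop ≫ b.unop.hom := by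
  rw [← spec_factor_iff]
  constructor
  · rintro ⟨h, rfl, rfl⟩
    exact ⟨h.unop, rfl, rfl⟩
  · rintro ⟨h, h1, h2⟩
    exact ⟨h.op, Quiver.Hom.unop_inj h1, Quiver.Hom.unop_inj h2⟩

/-- The specialization order of a positive `κ`-Borel locale `X`, as an internal partial order on the
underlying `κ`-Borel locale of `X`. -/
noncomputable def specOrder (X : BorPlusLoc κ) :
    InternalPartialOrder ((forgetBor κ).obj X) where
  rel := (forgetBor κ).obj (specLoc X)
  fst := (forgetBor κ).map (specFst X.unop).op
  snd := (forgetBor κ).map (specSnd X.unop).op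
  jointly_mono _ _ h1 h2 := Quiver.Hom.unop_inj (spec_bool_hom_ext
    (congrArg Quiver.Hom.unop h1) (congrArg Quiver.Hom.unop h2))
  refl a := (specLoc_rel_iff a a).2 le_rfl
  trans a b c h k := (specLoc_rel_iff a c).2
    (((specLoc_rel_iff a b).1 h).trans ((specLoc_rel_iff b c).1 k))
  antisymm a b h k := Quiver.Hom.unop_inj (free_hom_ext
    (le_antisymm ((specLoc_rel_iff a b).1 h) ((specLoc_rel_iff b a).1 k)))

/-- The forgetful functor from positive `κ`-Borel locales to `κ`-Borel polocales, equipping the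
underlying `κ`-Borel locale with the specialization order. -/
noncomputable def forgetPO (κ : Cardinal.{u}) : BorPlusLoc κ ⥤ BorPOLoc κ where
  obj X := ⟨(forgetBor κ).obj X, specOrder X⟩
  map {X Y} f := ⟨(forgetBor κ).map f, by
    refine (specLoc_rel_iff (X := Y) _ _).2 ?_
    change freeUnit Y.unop ≫ (((freeBool κ).map f.unop).hom ≫
      ((freeBool κ).map (specFst X.unop)).hom) ≤ freeUnit Y.unop ≫
      (((freeBool κ).map f.unop).hom ≫ ((freeBool κ).map (specSnd X.unop)).hom)
    rw [freeUnit_map_assoc, freeUnit_map_assoc, freeUnit_map, freeUnit_map]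
    exact spec_comp_le f.unop _⟩
  map_id X := POObj.Hom.ext ((forgetBor κ).map_id X)
  map_comp f g := POObj.Hom.ext ((forgetBor κ).map_comp f g)

/-- A `κ`-Borel set in a `κ`-Borel polocale is upper if its preimage under the first projection
from the order is contained in its preimage under the second. -/
def IsUpper (X : BorPOLoc κ) (B : BorelSet X.carrier) : Prop :=
  preimage X.order.fst B ≤ preimage X.order.snd B

/-- A `κ`-Borel set in (the underlying `κ`-Borel locale of) a positive `κ`-Borel locale `X` is
positive if it comes from an element of the `(κ, κ)`-frame dual to `X`. -/
def IsPositive (X : BorPlusLoc κ) (B : BorelSet ((forgetBor κ).obj X)) : Prop :=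
  ∃ U : X.unop, freeUnit X.unop U = B

end Locales

/-! ### `κ`-presented algebras, and the case `κ = ∞` -/

section Presentations

variable {κ : Cardinal.{u}}

/-- The free `(κ, κ)`-frame on a set. -/
noncomputable def freeFrm (κ : Cardinal.{u}) (G : Type u) : KKFrm κ :=
  presented (κ := κ) (G := G) fun _ _ => True

/-- The generators of the free `(κ, κ)`-frame. -/
def freeGen (κ : Cardinal.{u}) {G : Type u} (g : G) : freeFrm κ G := presGen _ g

/-- The homomorphism out of the free `(κ, κ)`-frame induced by a map of generators. -/
noncomputable def freeExt {G : Type u} {B : KKFrm κ} (f : G → B) : freeFrm κ G ⟶ B :=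
  presLift (M := fun _ _ => True) f trivial

@[simp] theorem freeExt_gen {G : Type u} {B : KKFrm κ} (f : G → B) (g : G) :
    freeExt f (freeGen κ g) = f g := rfl

theorem freeFrm_hom_ext {G : Type u} {B : KKFrm κ} {f g : freeFrm κ G ⟶ B}
    (h : ∀ x, f (freeGen κ x) = g (freeGen κ x)) : f = g :=
  pres_hom_ext h

/-- A `(κ, κ)`-frame is `κ`-presented if it is presented by a set `G` of generators and a family
of relations `r i = s i` (`i : R`) between elements of the free `(κ, κ)`-frame on `G`, where `G`
and `R` have size `< κ`. -/
def IsPresentedFrm (A : KKFrm κ) : Prop :=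
  ∃ (G R : Type u) (r s : R → freeFrm κ G) (q : freeFrm κ G ⟶ A),
    #G < κ ∧ #R < κ ∧ (∀ i, q (r i) = q (s i)) ∧
    ∀ (B : KKFrm κ) (f : freeFrm κ G ⟶ B), (∀ i, f (r i) = f (s i)) → ∃! g : A ⟶ B, q ≫ g = f

/-- The free `κ`-Boolean algebra on a set. -/
noncomputable def freeBA (κ : Cardinal.{u}) (G : Type u) : KBool κ := (freeBool κ).obj (freeFrm κ G)

/-- A `κ`-Boolean algebra is `κ`-presented if it is presented by a set `G` of generators and a
family of relations `r i = s i` (`i : R`) between elements of the free `κ`-Boolean algebra on `G`,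
where `G` and `R` have size `< κ`. -/
def IsPresentedBA (A : KBool κ) : Prop :=
  ∃ (G R : Type u) (r s : R → (freeBA κ G).obj) (q : freeBA κ G ⟶ A),
    #G < κ ∧ #R < κ ∧ (∀ i, q.hom (r i) = q.hom (s i)) ∧
    ∀ (B : KBool κ) (f : freeBA κ G ⟶ B), (∀ i, f.hom (r i) = f.hom (s i)) →
      ∃! g : A ⟶ B, q ≫ g = f

theorem isPresented_freeBool {A : KKFrm κ} (hA : IsPresentedFrm A) :
    IsPresentedBA ((freeBool κ).obj A) := by
  obtain ⟨G, R, r, s, q, hG, hR, hq, hu⟩ := hA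
  have key : ∀ (B : KBool κ) (f : freeBA κ G ⟶ B) (g : (freeBool κ).obj A ⟶ B),
      (freeBool κ).map q ≫ g = f ↔ q ≫ freeUnit A ≫ g.hom = freeUnit (freeFrm κ G) ≫ f.hom := by
    intro B f g
    rw [← freeUnit_map_assoc]
    exact ⟨fun h => by rw [← h]; rfl, fun h => free_hom_ext h⟩
  refine ⟨G, R, fun i => freeUnit _ (r i), fun i => freeUnit _ (s i), (freeBool κ).map q, hG, hR,
    fun i => ?_, fun B f hf => ?_⟩
  · have h := fun x => congrArg (fun k : freeFrm κ G ⟶ _ => k x) (freeUnit_map q)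
    exact (h (r i)).trans ((congrArg (fun x => freeUnit A x) (hq i)).trans (h (s i)).symm)
  · obtain ⟨g, hg, hg'⟩ := hu B.obj (freeUnit (freeFrm κ G) ≫ f.hom) hf
    refine ⟨freeLift g, (key _ _ _).2 (by rw [freeUnit_lift, hg]), fun k hk => ?_⟩
    exact free_hom_ext ((hg' _ ((key _ _ _).1 hk)).trans (freeUnit_lift g).symm)

/-- Inequalities between homomorphisms out of a presented algebra can be checked on generators. -/
theorem presented_le {A B : KKFrm κ} {G R : Type u} {r s : R → freeFrm κ G} {q : freeFrm κ G ⟶ A}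
    (hq : ∀ i, q (r i) = q (s i))
    (hu : ∀ (B : KKFrm κ) (f : freeFrm κ G ⟶ B), (∀ i, f (r i) = f (s i)) →
      ∃! g : A ⟶ B, q ≫ g = f)
    {f g : A ⟶ B} (h : ∀ x, f (q (freeGen κ x)) ≤ g (q (freeGen κ x))) : f ≤ g := by
  let M : Cond κ G := fun B f => ∀ i, freeExt f (r i) = freeExt f (s i)
  have hqe : freeExt (fun x => q (freeGen κ x)) = q := freeFrm_hom_ext fun _ => rfl
  let j : presented M ⟶ A := presLift (M := M) (fun x => q (freeGen κ x)) fun i => by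
    rw [hqe, hq]
  let c : freeFrm κ G ⟶ presented M := freeExt (presGen M)
  have hc : ∀ i, c (r i) = c (s i) := fun i => pres_ext fun B f hf => by
    have e : c ≫ presLift f hf = freeExt f := freeFrm_hom_ext fun _ => rfl
    have e' := fun x => congrArg (fun k : freeFrm κ G ⟶ B => k x) e
    exact (e' _).trans ((hf i).trans (e' _).symm)
  obtain ⟨e, he, -⟩ := hu _ c hc
  have hej : e ≫ j = 𝟙 A := by
    obtain ⟨_, -, h1⟩ := hu A q hq
    rw [h1 (𝟙 A) (Category.comp_id _)]
    refine h1 _ ?_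
    change q ≫ e ≫ j = q
    rw [← Category.assoc, he]
    exact freeFrm_hom_ext fun _ => rfl
  have key : ∀ p : presented M, f (j p) ≤ g (j p) := by
    intro p
    induction p using pres_induction with
    | hgen x => exact h x
    | hbot => rw [j.map_bot, f.map_bot, g.map_bot]
    | htop => rw [j.map_top, f.map_top, g.map_top]
    | hsup a b ha hb => rw [j.map_sup, f.map_sup, g.map_sup]; exact sup_le_sup ha hb
    | hinf a b ha hb => rw [j.map_inf, f.map_inf, g.map_inf]; exact inf_le_inf ha hb
    | hlub ι hι t ht =>
      rw [KKFrm.map_lub, KKFrm.map_lub, KKFrm.map_lub]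
      refine (B.isLUB_lub hι _).2 ?_
      rintro _ ⟨i, rfl⟩
      exact (ht i).trans ((B.isLUB_lub hι _).1 ⟨i, rfl⟩)
    | hglb ι hι t ht =>
      rw [KKFrm.map_glb, KKFrm.map_glb, KKFrm.map_glb]
      refine (B.isGLB_glb hι _).2 ?_
      rintro _ ⟨i, rfl⟩
      exact ((B.isGLB_glb hι _).1 ⟨i, rfl⟩).trans (ht i)
  intro a
  have ha : j (e a) = a := congrArg (fun k : A ⟶ A => k a) hej
  have := key (e a)
  rwa [ha] at this

theorem isPresented_specFrm (hκ : ℵ₀ ≤ κ) {A : KKFrm κ} (hA : IsPresentedFrm A) :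
    IsPresentedFrm (specFrm A) := by
  obtain ⟨G, R, r, s, q, hG, hR, hq, hu⟩ := hA
  let c₀ : freeFrm κ G ⟶ freeFrm κ (G ⊕ G) := freeExt fun x => freeGen κ (.inl x)
  let c₁ : freeFrm κ G ⟶ freeFrm κ (G ⊕ G) := freeExt fun x => freeGen κ (.inr x)
  let q' : freeFrm κ (G ⊕ G) ⟶ specFrm A := freeExt (Sum.elim
    (fun x => specFst A (q (freeGen κ x))) (fun x => specSnd A (q (freeGen κ x))))
  have e₀ : c₀ ≫ q' = q ≫ specFst A := freeFrm_hom_ext fun _ => rfl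
  have e₁ : c₁ ≫ q' = q ≫ specSnd A := freeFrm_hom_ext fun _ => rfl
  have e₀' := fun x => congrArg (fun k : freeFrm κ G ⟶ _ => k x) e₀
  have e₁' := fun x => congrArg (fun k : freeFrm κ G ⟶ _ => k x) e₁
  refine ⟨G ⊕ G, R ⊕ R ⊕ G,
    Sum.elim (fun i => c₀ (r i)) (Sum.elim (fun i => c₁ (r i))
      (fun x => freeGen κ (.inl x) ⊓ freeGen κ (.inr x))),
    Sum.elim (fun i => c₀ (s i)) (Sum.elim (fun i => c₁ (s i))
      (fun x => freeGen κ (.inl x))), q', ?_, ?_, ?_, ?_⟩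
  · rw [mk_sum, lift_id]
    exact add_lt_of_lt hκ hG hG
  · rw [mk_sum, mk_sum, lift_id, lift_id, lift_id]
    exact add_lt_of_lt hκ hR (add_lt_of_lt hκ hR hG)
  · rintro (i | i | x)
    · exact (e₀' _).trans ((congrArg (fun a => specFst A a) (hq i)).trans (e₀' _).symm)
    · exact (e₁' _).trans ((congrArg (fun a => specSnd A a) (hq i)).trans (e₁' _).symm)
    · exact (q'.map_inf _ _).trans (inf_eq_left.2 (specFst_le_specSnd A _))
  · intro B f hf
    obtain ⟨g₀, h₀, u₀⟩ := hu B (c₀ ≫ f) fun i => hf (.inl i)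
    obtain ⟨g₁, h₁, u₁⟩ := hu B (c₁ ≫ f) fun i => hf (.inr (.inl i))
    have k₀ := fun x => congrArg (fun k : freeFrm κ G ⟶ B => k x) h₀
    have k₁ := fun x => congrArg (fun k : freeFrm κ G ⟶ B => k x) h₁
    have hle : g₀ ≤ g₁ := presented_le hq hu fun x => by
      have h := hf (.inr (.inr x))
      have h' : f (freeGen κ (.inl x)) ≤ f (freeGen κ (.inr x)) :=
        inf_eq_left.1 ((f.map_inf _ _).symm.trans h)
      exact (k₀ (freeGen κ x)).trans_le (h'.trans_eq (k₁ (freeGen κ x)).symm)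
    refine ⟨specLift g₀ g₁ hle, ?_, fun k hk => ?_⟩
    · refine freeFrm_hom_ext ?_
      rintro (x | x)
      · exact k₀ (freeGen κ x)
      · exact k₁ (freeGen κ x)
    · refine spec_hom_ext ?_ ?_
      · rw [specFst_lift]
        refine u₀ _ ?_
        change q ≫ specFst A ≫ k = c₀ ≫ f
        rw [← Category.assoc, ← e₀, Category.assoc, hk]
      · rw [specSnd_lift]
        refine u₁ _ ?_
        change q ≫ specSnd A ≫ k = c₁ ≫ f
        rw [← Category.assoc, ← e₁, Category.assoc, hk]

end Presentations

section Infinity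

/-- The symbol `∞`: the cardinality of the class of all small sets, where a set is small if it is
in bijection with a type in `Type u`; "large" structures live in `Type (u + 1)`. Thus
`KKFrm infty.{u}` and `KBool infty.{u}` are the categories of large `(∞, ∞)`-frames and of large
complete Boolean algebras, respectively. -/
noncomputable abbrev infty : Cardinal.{u + 1} := Cardinal.univ.{u, u + 1}

theorem aleph0_le_infty : ℵ₀ ≤ infty.{u} := IsInaccessible.univ.isRegular.aleph0_le

/-- The category of small-presented large `(∞, ∞)`-frames. -/
abbrev InftyFrm : Type (u + 2) :=
  ObjectProperty.FullSubcategory (fun A : KKFrm infty.{u} => IsPresentedFrm A)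

/-- The category of small-presented large complete Boolean algebras. -/
abbrev InftyBA : Type (u + 2) :=
  ObjectProperty.FullSubcategory (fun A : KBool infty.{u} => IsPresentedBA A)

/-- The category of positive `∞`-Borel locales. -/
abbrev InftyBorPlusLoc : Type (u + 2) := InftyFrm.{u}ᵒᵖ

/-- The category of `∞`-Borel locales. -/
abbrev InftyBorLoc : Type (u + 2) := InftyBA.{u}ᵒᵖ

/-- The category of `∞`-Borel polocales. -/
abbrev InftyBorPOLoc : Type (u + 2) := POObj InftyBorLoc.{u}

/-- The free functor from small-presented large `(∞, ∞)`-frames to small-presented large complete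
Boolean algebras. -/
noncomputable abbrev inftyFreeBool : InftyFrm.{u} ⥤ InftyBA.{u} :=
  ObjectProperty.lift _ (ObjectProperty.ι _ ⋙ freeBool infty.{u})
    fun A => isPresented_freeBool A.property

/-- The `∞`-Borel locale underlying a positive `∞`-Borel locale. -/
noncomputable abbrev inftyForgetBor : InftyBorPlusLoc.{u} ⥤ InftyBorLoc.{u} := inftyFreeBool.op

/-- The order on a positive `∞`-Borel locale. -/
noncomputable abbrev inftySpecLoc (X : InftyBorPlusLoc.{u}) : InftyBorPlusLoc.{u} :=
  Opposite.op ⟨specFrm X.unop.obj, isPresented_specFrm aleph0_le_infty X.unop.property⟩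

/-- The first projection from the order on a positive `∞`-Borel locale. -/
noncomputable abbrev inftySpecFst (X : InftyBorPlusLoc.{u}) : inftySpecLoc X ⟶ X :=
  Quiver.Hom.op (X := X.unop) (Y := (inftySpecLoc X).unop)
    (ObjectProperty.homMk (specFst X.unop.obj))

/-- The second projection from the order on a positive `∞`-Borel locale. -/
noncomputable abbrev inftySpecSnd (X : InftyBorPlusLoc.{u}) : inftySpecLoc X ⟶ X :=
  Quiver.Hom.op (X := X.unop) (Y := (inftySpecLoc X).unop)
    (ObjectProperty.homMk (specSnd X.unop.obj))

theorem inftySpecLoc_rel_iff {X : InftyBorPlusLoc.{u}} {Z : InftyBorLoc.{u}}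
    (a b : Z ⟶ inftyForgetBor.obj X) :
    (∃ h : Z ⟶ inftyForgetBor.obj (inftySpecLoc X),
      h ≫ inftyForgetBor.map (inftySpecFst X) = a ∧
      h ≫ inftyForgetBor.map (inftySpecSnd X) = b) ↔
      freeUnit X.unop.obj ≫ a.unop.hom.hom ≤ freeUnit X.unop.obj ≫ b.unop.hom.hom := by
  rw [← spec_factor_iff]
  constructor
  · rintro ⟨h, rfl, rfl⟩
    exact ⟨h.unop.hom, rfl, rfl⟩
  · rintro ⟨h, h1, h2⟩
    exact ⟨Quiver.Hom.op (X := (inftyForgetBor.obj (inftySpecLoc X)).unop) (Y := Z.unop)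
      (ObjectProperty.homMk h), Quiver.Hom.unop_inj (ObjectProperty.hom_ext _ h1),
      Quiver.Hom.unop_inj (ObjectProperty.hom_ext _ h2)⟩

/-- The specialization order of a positive `∞`-Borel locale `X`, as an internal partial order on the
underlying `∞`-Borel locale of `X`. -/
noncomputable def inftySpecOrder (X : InftyBorPlusLoc.{u}) :
    InternalPartialOrder (inftyForgetBor.obj X) where
  rel := inftyForgetBor.obj (inftySpecLoc X)
  fst := inftyForgetBor.map (inftySpecFst X)
  snd := inftyForgetBor.map (inftySpecSnd X)
  jointly_mono _ _ h1 h2 := Quiver.Hom.unop_inj (ObjectProperty.hom_ext _ (spec_bool_hom_ext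
    (congrArg (fun f => f.unop.hom) h1) (congrArg (fun f => f.unop.hom) h2)))
  refl a := (inftySpecLoc_rel_iff a a).2 le_rfl
  trans a b c h k := (inftySpecLoc_rel_iff a c).2
    (((inftySpecLoc_rel_iff a b).1 h).trans ((inftySpecLoc_rel_iff b c).1 k))
  antisymm a b h k := Quiver.Hom.unop_inj (ObjectProperty.hom_ext _ (free_hom_ext
    (le_antisymm ((inftySpecLoc_rel_iff a b).1 h) ((inftySpecLoc_rel_iff b a).1 k))))

/-- The forgetful functor from positive `∞`-Borel locales to `∞`-Borel polocales, equipping the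
underlying `∞`-Borel locale with the specialization order. -/
noncomputable def inftyForgetPO : InftyBorPlusLoc.{u} ⥤ InftyBorPOLoc.{u} where
  obj X := ⟨inftyForgetBor.obj X, inftySpecOrder X⟩
  map {X Y} f := ⟨inftyForgetBor.map f, by
    refine (inftySpecLoc_rel_iff (X := Y) _ _).2 ?_
    change freeUnit Y.unop.obj ≫ (((freeBool infty).map f.unop.hom).hom ≫
      ((freeBool infty).map (specFst X.unop.obj)).hom) ≤ freeUnit Y.unop.obj ≫
      (((freeBool infty).map f.unop.hom).hom ≫ ((freeBool infty).map (specSnd X.unop.obj)).hom)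
    rw [freeUnit_map_assoc, freeUnit_map_assoc, freeUnit_map, freeUnit_map]
    exact spec_comp_le f.unop.hom _⟩
  map_id X := POObj.Hom.ext (inftyForgetBor.map_id X)
  map_comp f g := POObj.Hom.ext (inftyForgetBor.map_comp f g)

/-- The `∞`-Borel sets of an `∞`-Borel locale. -/
abbrev InftyBorelSet (X : InftyBorLoc.{u}) : Type (u + 1) := X.unop.obj.obj

/-- An `∞`-Borel set in an `∞`-Borel polocale is upper if its preimage under the first projection
from the order is contained in its preimage under the second. -/
def InftyIsUpper (X : InftyBorPOLoc.{u}) (B : InftyBorelSet X.carrier) : Prop :=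
  X.order.fst.unop.hom.hom B ≤ X.order.snd.unop.hom.hom B

/-- An `∞`-Borel set in a positive `∞`-Borel locale `X` is positive if it comes from an element of
the large `(∞, ∞)`-frame dual to `X`. -/
def InftyIsPositive (X : InftyBorPlusLoc.{u}) (B : InftyBorelSet (inftyForgetBor.obj X)) : Prop :=
  ∃ U : X.unop.obj, freeUnit X.unop.obj U = B

end Infinity

end KBorel

/-! Write `j : A ⟶ L` for the unit into the free `κ`-Boolean algebra. By the universal property of
the specialization order (`spec_factor_iff`), if `b` in `L` is upper, then `f b ≤ g b` for every
pair of homomorphisms `f`, `g` from `L` to a `κ`-Boolean algebra with `f ≤ g` on `A`. So for each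
`b` outside the image of `j` a pair violating this is needed (`exists_eq_of_forall_le`).

For finitary algebras one would separate by two ultrafilters. For `κ`-ary operations there may be no
points, so the pair is built generically, with values in a complete Boolean algebra of regular lower
sets. The conditions are the pairs `(x, z)` in `L` with no `a` in `A` such that `x ≤ j a ≤ z`;
refining shrinks `x` and enlarges `z`. A condition promises that `x` is true for `f` and that `z` is
false for `g`. If `f` made `j a` true and `g` made it false, some refinement would have `x ≤ j a ≤
z`, which is excluded; hence `f ≤ g` on `A`. But `(b, b)` is a condition, as an interpolant would
equal `b`, and it forces `b` to be true for `f` and false for `g`.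

That `f` and `g` preserve `κ`-ary joins and meets amounts to a density statement: a condition that
decides a join or meet can be refined to one that decides a suitable member. If no refinement
worked, interpolants for the pieces would combine, by a `κ`-ary join or meet in `A`, into an
interpolant for the original pair. These are the four lemmas `Interpolated.of_isLUB`, `of_isGLB`,
`of_inf_left` and `of_sup_right`.

The same construction on pairs `x ≰ y` in `A` itself shows that `j` is an order embedding
(`freeUnit_le_iff`), which gives faithfulness. For fullness, the homomorphism dual to an
order-preserving map takes upper elements to upper elements, hence positive ones to positive ones,
and so restricts along the embeddings. All of this needs only `ℵ₀ ≤ κ`, so `κ = ∞` is an instance: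
the test algebras range over all `κ`-Boolean algebras, small-presented or not. -/

namespace KBorel

/-! ### Boolean-valued homomorphisms from forcing relations -/

section Forcing

/-- The pseudocomplement of lower sets is forcing negation: no extension of `p` lies in `E`. -/
theorem mem_compl_lowerSet {P : Type u} [Preorder P] {E : LowerSet P} {p : P} :
    p ∈ Eᶜ ↔ ∀ q ≤ p, q ∉ E := by
  rw [← LowerSet.Iic_le, le_compl_iff_disjoint_right, disjoint_iff_inf_le]
  exact ⟨fun h q hq hE => h ⟨hq, hE⟩, fun h q hq => h q hq.1 hq.2⟩

theorem exists_isLUB_regular {H : Type u} [Order.Frame H] (S : Set (Heyting.Regular H)) :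
    ∃ s, IsLUB S s := by
  -- The join of regular elements is the double complement of their join in the frame.
  refine ⟨Heyting.Regular.toRegular (sSup ((fun a : Heyting.Regular H => (a : H)) '' S)), fun a ha => ?_,
    fun b hb => ?_⟩
  · rw [← Heyting.Regular.coe_le_coe, Heyting.Regular.coe_toRegular]
    exact (le_sSup (Set.mem_image_of_mem _ ha)).trans le_compl_compl
  · rw [← Heyting.Regular.coe_le_coe, Heyting.Regular.coe_toRegular]
    refine (compl_le_compl (compl_le_compl (sSup_le ?_))).trans b.2.eq.le
    rintro _ ⟨a, ha, rfl⟩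
    exact hb ha

/-- The complete Boolean algebra of regular lower sets of a preorder. -/
def regularFrm (κ : Cardinal.{u}) (P : Type u) [Preorder P] : KKFrm κ where
  carrier := Heyting.Regular (LowerSet P)
  isKKFrame := .of_booleanAlgebra fun S _ => exists_isLUB_regular S

instance (κ : Cardinal.{u}) (P : Type u) [Preorder P] : ComplementedLattice (regularFrm κ P) :=
  inferInstanceAs (ComplementedLattice (Heyting.Regular (LowerSet P)))

/-- The `κ`-Boolean algebra of regular lower sets of a preorder. -/
def regularBool (κ : Cardinal.{u}) (P : Type u) [Preorder P] : KBool κ :=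
  ⟨regularFrm κ P, inferInstance⟩

variable {κ : Cardinal.{u}} {A : KKFrm κ} {P : Type u} [Preorder P]

/-- A forcing relation between the conditions in `P` and the elements of `A`: `pos a` and `neg a`
are the sets of conditions that force `a` and the complement of `a`. -/
structure Forcing (A : KKFrm κ) (P : Type u) [Preorder P] where
  pos : A → LowerSet P
  neg : A → LowerSet P
  disjoint : ∀ {a p}, p ∈ pos a → p ∉ neg a
  decide : ∀ a p, ∃ q ≤ p, q ∈ pos a ∨ q ∈ neg a
  neg_anti : ∀ {a b}, a ≤ b → neg b ≤ neg a
  pos_isLUB : ∀ S : Set A, #S < κ → ∀ s, IsLUB S s → ∀ p ∈ pos s, ∃ a ∈ S, ∃ q ≤ p, q ∈ pos a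
  neg_isGLB : ∀ S : Set A, #S < κ → ∀ s, IsGLB S s → ∀ p ∈ neg s, ∃ a ∈ S, ∃ q ≤ p, q ∈ neg a

namespace Forcing

variable (F : Forcing A P)

/-- The regular lower set of conditions no extension of which forces the complement of `a`. -/
def val (a : A) : regularFrm κ P :=
  (⟨(F.neg a)ᶜ, Heyting.isRegular_compl _⟩ : Heyting.Regular (LowerSet P))

/-- The set of conditions at which `x` holds. -/
def truth (x : regularFrm κ P) : LowerSet P := ((show Heyting.Regular (LowerSet P) from x) :)

theorem mem_val {a : A} {p : P} : p ∈ truth (F.val a) ↔ ∀ q ≤ p, q ∉ F.neg a :=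
  mem_compl_lowerSet

theorem le_iff {x y : regularFrm κ P} : x ≤ y ↔ truth x ≤ truth y := Iff.rfl

/-- Regularity means being equal to the double complement, and that consists of the conditions below
which the set is dense. -/
theorem mem_of_dense {x : regularFrm κ P} {p : P} (h : ∀ q ≤ p, ∃ r ≤ q, r ∈ truth x) :
    p ∈ truth x := by
  have hx : (truth x)ᶜᶜ = truth x := Subtype.prop (show Heyting.Regular (LowerSet P) from x)
  rw [← hx, mem_compl_lowerSet]
  intro q hq hq'
  obtain ⟨r, hr, hr'⟩ := h q hq
  exact mem_compl_lowerSet.1 hq' r hr hr'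

theorem pos_le_val (a : A) : F.pos a ≤ truth (F.val a) := fun _ hp =>
  F.mem_val.2 fun _ hq => F.disjoint ((F.pos a).lower hq hp)

theorem val_mono {a b : A} (h : a ≤ b) : F.val a ≤ F.val b := fun _ hp =>
  F.mem_val.2 fun q hq hq' => F.mem_val.1 hp q hq (F.neg_anti h hq')

/-- `val` is defined through `neg`, which makes it regular and handles meets directly. For joins one
needs `pos` to be dense in it, and this is where `decide` enters. -/
theorem exists_pos {a : A} {p : P} (h : p ∈ truth (F.val a)) : ∃ q ≤ p, q ∈ F.pos a := by
  obtain ⟨q, hq, hq' | hq'⟩ := F.decide a p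
  · exact ⟨q, hq, hq'⟩
  · exact (F.mem_val.1 h q hq hq').elim

theorem val_isLUB (S : Set A) (hS : #S < κ) (s : A) (hs : IsLUB S s) :
    IsLUB (F.val '' S) (F.val s) := by
  refine ⟨?_, fun t ht => ?_⟩
  · rintro _ ⟨a, ha, rfl⟩
    exact F.val_mono (hs.1 ha)
  · refine le_iff.2 fun p hp => mem_of_dense fun q hq => ?_
    obtain ⟨r, hr, hr'⟩ := F.exists_pos ((truth (F.val s)).lower hq hp)
    obtain ⟨a, ha, r', hr1, hr2⟩ := F.pos_isLUB S hS s hs r hr'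
    exact ⟨r', hr1.trans hr, le_iff.1 (ht ⟨a, ha, rfl⟩) (F.pos_le_val a hr2)⟩

theorem val_isGLB (S : Set A) (hS : #S < κ) (s : A) (hs : IsGLB S s) :
    IsGLB (F.val '' S) (F.val s) := by
  refine ⟨?_, fun t ht => ?_⟩
  · rintro _ ⟨a, ha, rfl⟩
    exact F.val_mono (hs.1 ha)
  · refine le_iff.2 fun p hp => F.mem_val.2 fun q hq hq' => ?_
    obtain ⟨a, ha, r, hr, hr'⟩ := F.neg_isGLB S hS s hs q hq'
    exact F.mem_val.1 (le_iff.1 (ht ⟨a, ha, rfl⟩) hp) r (hr.trans hq) hr'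

/-- The homomorphism to the algebra of regular lower sets induced by a forcing relation. -/
def hom (hκ : ℵ₀ ≤ κ) : A ⟶ regularFrm κ P where
  toFun := F.val
  map_bot := by
    -- The finite operations are the `κ`-ary ones for the empty set and for pairs.
    have := F.val_isLUB ∅ (by simpa using aleph0_pos.trans_le hκ) ⊥ isLUB_empty
    rw [Set.image_empty] at this
    exact this.unique isLUB_empty
  map_top := by
    have := F.val_isGLB ∅ (by simpa using aleph0_pos.trans_le hκ) ⊤ isGLB_empty
    rw [Set.image_empty] at this
    exact this.unique isGLB_empty
  map_sup a b := by
    have := F.val_isLUB {a, b} ((Set.toFinite _).lt_aleph0.trans_le hκ) _ isLUB_pair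
    rw [Set.image_pair] at this
    exact this.unique isLUB_pair
  map_inf a b := by
    have := F.val_isGLB {a, b} ((Set.toFinite _).lt_aleph0.trans_le hκ) _ isGLB_pair
    rw [Set.image_pair] at this
    exact this.unique isGLB_pair
  map_isLUB := F.val_isLUB
  map_isGLB := F.val_isGLB

end Forcing

end Forcing

/-! ### The unit is injective -/

section Injective

variable {κ : Cardinal.{u}}

/-- Pairs of elements of `A` the first of which is not below the second, ordered by refinement. -/
def Gap (A : KKFrm κ) : Type u := {p : A × Aᵒᵈ // ¬ p.1 ≤ OrderDual.ofDual p.2}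

instance (A : KKFrm κ) : Preorder (Gap A) :=
  inferInstanceAs (Preorder {p : A × Aᵒᵈ // ¬ p.1 ≤ OrderDual.ofDual p.2})

theorem Gap.exists_le {A : KKFrm κ} (p : Gap A) {x y : A} (hx : x ≤ p.1.1)
    (hy : OrderDual.ofDual p.1.2 ≤ y) (h : ¬ x ≤ y) :
    ∃ q ≤ p, q.1.1 = x ∧ OrderDual.ofDual q.1.2 = y :=
  ⟨⟨(x, OrderDual.toDual y), h⟩, ⟨hx, hy⟩, rfl, rfl⟩

/-- A pair `(x, y)` forces the elements above `x` and the complements of the elements below `y`. -/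
def gapForcing (A : KKFrm κ) : Forcing A (Gap A) where
  pos a := ⟨{p | p.1.1 ≤ a}, fun _ _ h hp => le_trans h.1 hp⟩
  neg a := ⟨{p | a ≤ OrderDual.ofDual p.1.2}, fun _ _ h hp => le_trans hp h.2⟩
  disjoint {_ p} h k := p.2 (le_trans h k)
  decide a p := by
    -- For `p = (x, y)`, one of `(x ⊓ a, y)` and `(x, y ⊔ a)` is again a gap. Otherwise `x ⊓ a ≤ y`
    -- and `x ≤ y ⊔ a`, so `x ≤ y` by distributivity (the cut rule).
    by_cases h : p.1.1 ⊓ a ≤ OrderDual.ofDual p.1.2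
    · have h' : ¬ p.1.1 ≤ OrderDual.ofDual p.1.2 ⊔ a := fun h' => p.2
        (le_of_inf_le_sup_le (z := a) (le_inf h inf_le_right) (sup_le h' le_sup_right))
      obtain ⟨q, hq, -, h2⟩ := p.exists_le le_rfl le_sup_left h'
      exact ⟨q, hq, .inr (le_sup_right.trans_eq h2.symm)⟩
    · obtain ⟨q, hq, h1, -⟩ := p.exists_le inf_le_left le_rfl h
      exact ⟨q, hq, .inl (h1.trans_le inf_le_right)⟩
  neg_anti h _ hp := le_trans h hp
  pos_isLUB S hS s hs p hp := by
    by_contra! H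
    refine p.2 ?_
    have hp' : p.1.1 ⊓ s = p.1.1 := inf_eq_left.2 hp
    rw [← hp']
    -- If no refinement forces a member of `S`, then `x ⊓ a ≤ y` for all `a ∈ S`; distributing `x`
    -- over the join gives `x = x ⊓ s ≤ y`. The clause for meets is dual.
    refine (A.isKKFrame.inf_isLUB S hS s hs p.1.1).2 ?_
    rintro _ ⟨a, ha, rfl⟩
    by_contra h
    obtain ⟨q, hq, h1, -⟩ := p.exists_le inf_le_left le_rfl h
    exact H a ha q hq (h1.trans_le inf_le_right)
  neg_isGLB S hS s hs p hp := by
    by_contra! H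
    refine p.2 ?_
    have hp' : OrderDual.ofDual p.1.2 ⊔ s = OrderDual.ofDual p.1.2 := sup_eq_left.2 hp
    rw [← hp']
    refine (A.isKKFrame.sup_isGLB S hS s hs _).2 ?_
    rintro _ ⟨a, ha, rfl⟩
    by_contra h
    obtain ⟨q, hq, -, h2⟩ := p.exists_le le_rfl le_sup_left h
    exact H a ha q hq (le_sup_right.trans_eq h2.symm)

/-- If `a ≰ b`, the gap `(a, b)` forces `a` and the complement of `b`. The homomorphism given by
`gapForcing` therefore separates `a` from `b`, and it extends along the unit. -/
theorem freeUnit_le_iff (hκ : ℵ₀ ≤ κ) {A : KKFrm κ} {a b : A} :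
    freeUnit A a ≤ freeUnit A b ↔ a ≤ b := by
  refine ⟨fun h => ?_, KKFrm.hom_mono _⟩
  by_contra hab
  have h' := KKFrm.hom_mono (freeLift (B := regularBool κ (Gap A)) ((gapForcing A).hom hκ)).hom h
  have e := fun x => congrArg (fun k : A ⟶ _ => k x)
    (freeUnit_lift (B := regularBool κ (Gap A)) ((gapForcing A).hom hκ))
  have h2 : (gapForcing A).val a ≤ (gapForcing A).val b := (e a).symm.trans_le (h'.trans_eq (e b))
  let p : Gap A := ⟨(a, OrderDual.toDual b), hab⟩
  have hp : p ∈ Forcing.truth ((gapForcing A).val b) :=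
    h2 ((gapForcing A).pos_le_val a (le_refl a : p.1.1 ≤ a))
  exact (gapForcing A).mem_val.1 hp p le_rfl (le_refl b : b ≤ OrderDual.ofDual p.1.2)

theorem freeUnit_injective (hκ : ℵ₀ ≤ κ) (A : KKFrm κ) : Function.Injective (freeUnit A) :=
  fun _ _ h => le_antisymm ((freeUnit_le_iff hκ).1 h.le) ((freeUnit_le_iff hκ).1 h.ge)

end Injective

/-! ### Interpolation -/

section Interpolation

variable {κ : Cardinal.{u}} {A L : KKFrm κ}

/-- An element of the image of `j` lies between `x` and `z`. -/
def Interpolated (j : A ⟶ L) (x z : L) : Prop := ∃ a, x ≤ j a ∧ j a ≤ z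

/-- The join of the interpolants for the pieces `x ⊓ u` works, since `x` is the join of these pieces
and `j` preserves `κ`-ary joins. -/
theorem Interpolated.of_isLUB {j : A ⟶ L} {S : Set L} (hS : #S < κ) {x s z : L}
    (hs : IsLUB S s) (hx : x ≤ s) (h : ∀ u ∈ S, Interpolated j (x ⊓ u) z) :
    Interpolated j x z := by
  choose! a ha using h
  have hS' : #S < κ := hS
  refine ⟨A.lub hS' fun u => a u.1, ?_, ?_⟩
  · rw [KKFrm.map_lub, ← inf_eq_left.2 hx]
    refine (L.isKKFrame.inf_isLUB S hS s hs x).2 ?_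
    rintro _ ⟨u, hu, rfl⟩
    exact (ha u hu).1.trans ((L.isLUB_lub hS' _).1 ⟨⟨u, hu⟩, rfl⟩)
  · rw [KKFrm.map_lub]
    refine (L.isLUB_lub hS' _).2 ?_
    rintro _ ⟨u, rfl⟩
    exact (ha u.1 u.2).2

/-- Order dual of `of_isLUB`: the interpolants are combined by a meet. -/
theorem Interpolated.of_isGLB {j : A ⟶ L} {S : Set L} (hS : #S < κ) {x s z : L}
    (hs : IsGLB S s) (hz : s ≤ z) (h : ∀ u ∈ S, Interpolated j x (z ⊔ u)) :
    Interpolated j x z := by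
  choose! a ha using h
  have hS' : #S < κ := hS
  refine ⟨A.glb hS' fun u => a u.1, ?_, ?_⟩
  · rw [KKFrm.map_glb]
    refine (L.isGLB_glb hS' _).2 ?_
    rintro _ ⟨u, rfl⟩
    exact (ha u.1 u.2).1
  · rw [KKFrm.map_glb, ← sup_eq_left.2 hz]
    refine (L.isKKFrame.sup_isGLB S hS s hs z).2 ?_
    rintro _ ⟨u, hu, rfl⟩
    exact ((L.isGLB_glb hS' _).1 ⟨⟨u, hu⟩, rfl⟩).trans (ha u hu).2

/-- Let `a` be the join of the interpolants for the `x ⊓ u'`. Splitting `x` along `u ⊔ u' = ⊤` gives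
`x ≤ j a ⊔ u` for each `u ∈ S`, so `x ≤ j a ⊔ s` because joins distribute over `κ`-ary meets. As `x`
is disjoint from `s`, this leaves `x ≤ j a`. -/
theorem Interpolated.of_inf_left {j : A ⟶ L} {S : Set L} (hS : #S < κ) {x s z : L}
    (hs : IsGLB S s) (hx : Disjoint x s)
    (h : ∀ u ∈ S, ∃ u', Codisjoint u u' ∧ Interpolated j (x ⊓ u') z) :
    Interpolated j x z := by
  choose! c hc a ha using h
  have hS' : #S < κ := hS
  refine ⟨A.lub hS' fun u => a u.1, ?_, ?_⟩
  · refine Disjoint.left_le_of_le_sup_right ?_ hx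
    refine (L.isKKFrame.sup_isGLB S hS s hs _).2 ?_
    rintro _ ⟨u, hu, rfl⟩
    rw [KKFrm.map_lub]
    have h1 : j (a u) ≤ L.lub hS' fun u => j (a u.1) := (L.isLUB_lub hS' _).1 ⟨⟨u, hu⟩, rfl⟩
    calc x = x ⊓ (u ⊔ c u) := by rw [(hc u hu).eq_top, inf_top_eq]
      _ = (x ⊓ u) ⊔ (x ⊓ c u) := inf_sup_left _ _ _
      _ ≤ _ := sup_le (inf_le_right.trans le_sup_right)
        (((ha u hu).1.trans h1).trans le_sup_left)
  · rw [KKFrm.map_lub]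
    refine (L.isLUB_lub hS' _).2 ?_
    rintro _ ⟨u, rfl⟩
    exact (ha u.1 u.2).2

/-- Order dual of `of_inf_left`: for the meet `a` of the interpolants, `j a ⊓ u ≤ z` for each `u ∈
S`, so `j a ⊓ s ≤ z`, and `z ⊔ s = ⊤` leaves `j a ≤ z`. -/
theorem Interpolated.of_sup_right {j : A ⟶ L} {S : Set L} (hS : #S < κ) {x s z : L}
    (hs : IsLUB S s) (hz : Codisjoint z s)
    (h : ∀ u ∈ S, ∃ u', Disjoint u u' ∧ Interpolated j x (z ⊔ u')) :
    Interpolated j x z := by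
  choose! c hc a ha using h
  have hS' : #S < κ := hS
  refine ⟨A.glb hS' fun u => a u.1, ?_, ?_⟩
  · rw [KKFrm.map_glb]
    refine (L.isGLB_glb hS' _).2 ?_
    rintro _ ⟨u, rfl⟩
    exact (ha u.1 u.2).1
  · refine Codisjoint.left_le_of_le_inf_right ?_ hz.symm
    refine (L.isKKFrame.inf_isLUB S hS s hs _).2 ?_
    rintro _ ⟨u, hu, rfl⟩
    rw [KKFrm.map_glb]
    have h1 : (L.glb hS' fun u => j (a u.1)) ≤ j (a u) := (L.isGLB_glb hS' _).1 ⟨⟨u, hu⟩, rfl⟩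
    calc _ ≤ (z ⊔ u) ⊓ (z ⊔ c u) :=
          le_inf (inf_le_right.trans le_sup_right) ((inf_le_left.trans h1).trans (ha u hu).2)
      _ = z ⊔ (u ⊓ c u) := (sup_inf_left _ _ _).symm
      _ = z := by rw [(hc u hu).eq_bot, sup_bot_eq]

/-- Pairs of elements of `L` that are not interpolated by an element of `A`, ordered by
refinement. -/
def NonInterpolated (j : A ⟶ L) : Type u :=
  {p : L × Lᵒᵈ // ¬ Interpolated j p.1 (OrderDual.ofDual p.2)}

instance (j : A ⟶ L) : Preorder (NonInterpolated j) :=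
  inferInstanceAs (Preorder {p : L × Lᵒᵈ // ¬ Interpolated j p.1 (OrderDual.ofDual p.2)})

namespace NonInterpolated

variable {j : A ⟶ L}

/-- The first component. -/
def lo (p : NonInterpolated j) : L := p.1.1

/-- The second component. -/
def hi (p : NonInterpolated j) : L := OrderDual.ofDual p.1.2

theorem le_def {p q : NonInterpolated j} : q ≤ p ↔ q.lo ≤ p.lo ∧ p.hi ≤ q.hi := Iff.rfl

theorem prop (p : NonInterpolated j) : ¬ Interpolated j p.lo p.hi := p.2

theorem not_le (p : NonInterpolated j) (a : A) (h : p.lo ≤ j a) : ¬ j a ≤ p.hi :=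
  fun k => p.prop ⟨a, h, k⟩

/-- The contrapositive shape in which density is proved: when no refinement of `p` has `Q`, the
candidate `(p.lo ⊓ x, p.hi)` cannot be a condition, so its components are interpolated. -/
theorem interpolated_lo {p : NonInterpolated j} {x : L} {Q : NonInterpolated j → Prop}
    (H : ∀ q ≤ p, ¬ Q q) (hQ : ∀ q, q.lo = p.lo ⊓ x → Q q) : Interpolated j (p.lo ⊓ x) p.hi := by
  by_contra h
  exact H ⟨(p.lo ⊓ x, OrderDual.toDual p.hi), h⟩ ⟨inf_le_left, le_rfl⟩ (hQ _ rfl)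

theorem interpolated_hi {p : NonInterpolated j} {x : L} {Q : NonInterpolated j → Prop}
    (H : ∀ q ≤ p, ¬ Q q) (hQ : ∀ q, q.hi = p.hi ⊔ x → Q q) : Interpolated j p.lo (p.hi ⊔ x) := by
  by_contra h
  exact H ⟨(p.lo, OrderDual.toDual (p.hi ⊔ x)), h⟩ ⟨le_rfl, le_sup_left (a := p.hi)⟩ (hQ _ rfl)

/-- Otherwise `j ⊥` would interpolate. This keeps a condition from forcing both an element and its
complement. -/
theorem lo_ne_bot (p : NonInterpolated j) : p.lo ≠ ⊥ := fun h =>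
  p.prop ⟨⊥, h.trans_le bot_le, j.map_bot.trans_le bot_le⟩

theorem hi_ne_top (p : NonInterpolated j) : p.hi ≠ ⊤ := fun h =>
  p.prop ⟨⊤, le_top.trans_eq j.map_top.symm, le_top.trans_eq h.symm⟩

/-- The forcing relation given by the first components. -/
def loForcing [ComplementedLattice L] (hκ : ℵ₀ ≤ κ) (j : A ⟶ L) :
    Forcing L (NonInterpolated j) where
  pos u := ⟨{p | p.lo ≤ u}, fun _ _ h hp => (le_def.1 h).1.trans hp⟩
  neg u := ⟨{p | Disjoint p.lo u}, fun _ _ h hp => Disjoint.mono_left (le_def.1 h).1 hp⟩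
  disjoint {_ p} h k := p.lo_ne_bot (disjoint_self.1 (Disjoint.mono_right h k))
  decide u p := by
    by_contra! H
    obtain ⟨c, hc⟩ := exists_isCompl u
    -- If neither `u` nor its complement `c` can be forced, both `p.lo ⊓ u` and `p.lo ⊓ c` are
    -- interpolated below `p.hi`, and hence so is `p.lo`.
    refine p.prop (.of_isLUB (S := {u, c}) ((Set.toFinite _).lt_aleph0.trans_le hκ) isLUB_pair
      (hc.sup_eq_top ▸ le_top) ?_)
    rintro _ (rfl | rfl)
    · exact interpolated_lo (fun q hq => (H q hq).1) fun q hq => hq.trans_le inf_le_right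
    · exact interpolated_lo (fun q hq => (H q hq).2) fun q hq =>
        hc.symm.disjoint.mono_left (hq.trans_le inf_le_right)
  neg_anti h _ hp := Disjoint.mono_right h hp
  pos_isLUB S hS s hs p hp := by
    by_contra! H
    exact p.prop (.of_isLUB hS hs hp fun u hu =>
      interpolated_lo (H u hu) fun q hq => hq.trans_le inf_le_right)
  neg_isGLB S hS s hs p hp := by
    by_contra! H
    -- To force the complement of a member `u`, the first component is cut down to a complement `c`
    -- of `u`.
    refine p.prop (.of_inf_left hS hs hp fun u hu => ?_)
    obtain ⟨c, hc⟩ := exists_isCompl u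
    exact ⟨c, hc.codisjoint, interpolated_lo (H u hu) fun q hq =>
      hc.symm.disjoint.mono_left (hq.trans_le inf_le_right)⟩

/-- The forcing relation given by the second components. -/
def hiForcing [ComplementedLattice L] (hκ : ℵ₀ ≤ κ) (j : A ⟶ L) :
    Forcing L (NonInterpolated j) where
  -- Since `p.hi` is to be false, `u` is forced true when its complement lies below `p.hi`, that is,
  -- when `p.hi ⊔ u = ⊤`.
  pos u := ⟨{p | Codisjoint p.hi u}, fun _ _ h hp => Codisjoint.mono_left (le_def.1 h).2 hp⟩
  neg u := ⟨{p | u ≤ p.hi}, fun _ _ h hp => le_trans hp (le_def.1 h).2⟩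
  disjoint {_ p} h k := p.hi_ne_top (codisjoint_self.1 (Codisjoint.mono_right k h))
  decide u p := by
    by_contra! H
    obtain ⟨c, hc⟩ := exists_isCompl u
    refine p.prop (.of_isGLB (S := {u, c}) ((Set.toFinite _).lt_aleph0.trans_le hκ) isGLB_pair
      (hc.inf_eq_bot ▸ bot_le) ?_)
    rintro _ (rfl | rfl)
    · exact interpolated_hi (fun q hq => (H q hq).2) fun q hq => le_sup_right.trans_eq hq.symm
    · exact interpolated_hi (fun q hq => (H q hq).1) fun q hq =>
        hc.symm.codisjoint.mono_left (le_sup_right.trans_eq hq.symm)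
  neg_anti h _ hp := le_trans h hp
  pos_isLUB S hS s hs p hp := by
    by_contra! H
    refine p.prop (.of_sup_right hS hs hp fun u hu => ?_)
    obtain ⟨c, hc⟩ := exists_isCompl u
    exact ⟨c, hc.disjoint, interpolated_hi (H u hu) fun q hq =>
      hc.symm.codisjoint.mono_left (le_sup_right.trans_eq hq.symm)⟩
  neg_isGLB S hS s hs p hp := by
    by_contra! H
    exact p.prop (.of_isGLB hS hs hp fun u hu =>
      interpolated_hi (H u hu) fun q hq => le_sup_right.trans_eq hq.symm)

/-- A violation would yield a condition `r` with `r.lo ≤ j a ≤ r.hi`, making `a` an interpolant of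
`r`. -/
theorem loForcing_le_hiForcing [ComplementedLattice L] (hκ : ℵ₀ ≤ κ) (j : A ⟶ L) (a : A) :
    (loForcing hκ j).val (j a) ≤ (hiForcing hκ j).val (j a) := by
  refine Forcing.le_iff.2 fun p hp => (hiForcing hκ j).mem_val.2 fun q hq hq' => ?_
  obtain ⟨r, hr, hr'⟩ := (loForcing hκ j).exists_pos ((Forcing.truth _).lower hq hp)
  exact r.not_le a hr' (le_trans hq' (le_def.1 hr).2)

end NonInterpolated

/-- An element of a `κ`-Boolean algebra `L` that is preserved by all pairs of homomorphisms from `L`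
which are ordered on `A` comes from `A`. -/
theorem exists_eq_of_forall_le [ComplementedLattice L] (hκ : ℵ₀ ≤ κ) (j : A ⟶ L) (b : L)
    (h : ∀ (B : KBool κ) (f g : L ⟶ B.obj), j ≫ f ≤ j ≫ g → f b ≤ g b) : ∃ a, j a = b := by
  by_contra hb
  -- The diagonal pair is a condition exactly because `b` is not in the image of `j`. It lies in the
  -- first value of `b` but not in the second.
  let p : NonInterpolated j := ⟨(b, OrderDual.toDual b), fun ⟨a, h1, h2⟩ =>
    hb ⟨a, le_antisymm h2 h1⟩⟩
  have hle : (NonInterpolated.loForcing hκ j).val b ≤ (NonInterpolated.hiForcing hκ j).val b :=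
    h (regularBool κ (NonInterpolated j)) ((NonInterpolated.loForcing hκ j).hom hκ)
      ((NonInterpolated.hiForcing hκ j).hom hκ) (NonInterpolated.loForcing_le_hiForcing hκ j)
  have hp : p ∈ Forcing.truth ((NonInterpolated.hiForcing hκ j).val b) :=
    hle ((NonInterpolated.loForcing hκ j).pos_le_val b (le_refl b : p.lo ≤ b))
  exact (NonInterpolated.hiForcing hκ j).mem_val.1 hp p le_rfl (le_refl b : b ≤ p.hi)

end Interpolation

/-! ### Upper sets and order-preserving maps -/

section Upper

variable {κ : Cardinal.{u}}

theorem freeMap_unit {A B : KKFrm κ} (f : A ⟶ B) (a : A) :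
    ((freeBool κ).map f).hom (freeUnit A a) = freeUnit B (f a) :=
  congrArg (fun k : A ⟶ _ => k a) (freeUnit_map f)

theorem upper_iff_mem_range_freeUnit (hκ : ℵ₀ ≤ κ) {A : KKFrm κ} (b : ((freeBool κ).obj A).obj) :
    ((freeBool κ).map (specFst A)).hom b ≤ ((freeBool κ).map (specSnd A)).hom b ↔
      ∃ a, freeUnit A a = b := by
  constructor
  · intro hb
    have := ((freeBool κ).obj A).property
    refine exists_eq_of_forall_le hκ (freeUnit A) b fun B f g hfg => ?_
    -- A pair ordered on `A` factors through the algebra of the specialization order, so upperness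
    -- of `b` is carried to `f b ≤ g b` by the monotone map `h`.
    obtain ⟨h, h1, h2⟩ := (spec_factor_iff (ObjectProperty.homMk f : (freeBool κ).obj A ⟶ B)
      (ObjectProperty.homMk g)).2 hfg
    have e1 : h.hom (((freeBool κ).map (specFst A)).hom b) = f b :=
      congrArg (fun k : (freeBool κ).obj A ⟶ B => k.hom b) h1
    have e2 : h.hom (((freeBool κ).map (specSnd A)).hom b) = g b :=
      congrArg (fun k : (freeBool κ).obj A ⟶ B => k.hom b) h2
    rw [← e1, ← e2]
    exact KKFrm.hom_mono h.hom hb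
  · rintro ⟨a, rfl⟩
    rw [freeMap_unit, freeMap_unit]
    exact KKFrm.hom_mono _ (specFst_le_specSnd A a)

/-- A homomorphism that takes values in the image of an order embedding factors through it. -/
theorem exists_hom_of_range {A B L : KKFrm κ} (i : B ⟶ L) (hi : ∀ a b, i a ≤ i b ↔ a ≤ b)
    (f : A ⟶ L) (hf : ∀ a, ∃ b, i b = f a) : ∃ g : A ⟶ B, g ≫ i = f := by
  choose g hg using hf
  have inj : ∀ {a b}, i a = i b → a = b := fun h =>
    le_antisymm ((hi _ _).1 h.le) ((hi _ _).1 h.ge)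
  refine ⟨⟨g, ?_, ?_, fun a b => ?_, fun a b => ?_, fun S hS s hs => ?_, fun S hS s hs => ?_⟩,
    KKFrm.hom_ext hg⟩
  · exact inj (by rw [hg, f.map_bot, i.map_bot])
  · exact inj (by rw [hg, f.map_top, i.map_top])
  · exact inj (by rw [hg, f.map_sup, i.map_sup, hg, hg])
  · exact inj (by rw [hg, f.map_inf, i.map_inf, hg, hg])
  · have h := f.map_isLUB S hS s hs
    -- Because `i` reflects the order, a bound in `L` attained at a value of `i` is already a bound
    -- in `B`.
    refine ⟨?_, fun b hb => (hi _ _).1 ?_⟩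
    · rintro _ ⟨a, ha, rfl⟩
      exact (hi _ _).1 (by rw [hg, hg]; exact h.1 ⟨a, ha, rfl⟩)
    · rw [hg]
      refine h.2 ?_
      rintro _ ⟨a, ha, rfl⟩
      rw [← hg, hi]
      exact hb ⟨a, ha, rfl⟩
  · have h := f.map_isGLB S hS s hs
    refine ⟨?_, fun b hb => (hi _ _).1 ?_⟩
    · rintro _ ⟨a, ha, rfl⟩
      exact (hi _ _).1 (by rw [hg, hg]; exact h.1 ⟨a, ha, rfl⟩)
    · rw [hg]
      refine h.2 ?_
      rintro _ ⟨a, ha, rfl⟩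
      rw [← hg, hi]
      exact hb ⟨a, ha, rfl⟩

/-- A homomorphism between free `κ`-Boolean algebras that is compatible with the specialization
orders comes from a homomorphism of `(κ, κ)`-frames. -/
theorem exists_map_eq (hκ : ℵ₀ ≤ κ) {A B : KKFrm κ}
    (f : (freeBool κ).obj A ⟶ (freeBool κ).obj B)
    (h : (freeBool κ).obj (specFrm A) ⟶ (freeBool κ).obj (specFrm B))
    (h1 : (freeBool κ).map (specFst A) ≫ h = f ≫ (freeBool κ).map (specFst B))
    (h2 : (freeBool κ).map (specSnd A) ≫ h = f ≫ (freeBool κ).map (specSnd B)) :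
    ∃ g : A ⟶ B, (freeBool κ).map g = f := by
  obtain ⟨g, hg⟩ := exists_hom_of_range (freeUnit B) (fun _ _ => freeUnit_le_iff hκ)
    (freeUnit A ≫ f.hom) fun a => by
      -- Positive elements are upper, `h` transports the defining inequality through the two
      -- commuting squares, and upper elements are positive again.
      refine (upper_iff_mem_range_freeUnit hκ _).1 ?_
      have e1 := congrArg (fun k : (freeBool κ).obj A ⟶ _ => k.hom (freeUnit A a)) h1
      have e2 := congrArg (fun k : (freeBool κ).obj A ⟶ _ => k.hom (freeUnit A a)) h2
      refine e1.symm.trans_le (le_trans ?_ e2.le)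
      exact KKFrm.hom_mono h.hom ((upper_iff_mem_range_freeUnit hκ _).2 ⟨a, rfl⟩)
  exact ⟨g, free_hom_ext ((freeUnit_map g).trans hg)⟩

/-! ### Fullness and faithfulness of the forgetful functors -/

theorem freeBool_map_injective (hκ : ℵ₀ ≤ κ) {A B : KKFrm κ} {f g : A ⟶ B}
    (h : (freeBool κ).map f = (freeBool κ).map g) : f = g :=
  KKFrm.hom_ext fun a => freeUnit_injective hκ B (by rw [← freeMap_unit, h, freeMap_unit])

theorem forgetPO_full (hκ : ℵ₀ ≤ κ) : (forgetPO κ).Full where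
  map_surjective {X Y} f := by
    obtain ⟨h, h1, h2⟩ := f.mono
    obtain ⟨g, hg⟩ := exists_map_eq hκ f.hom.unop h.unop (congrArg Quiver.Hom.unop h1)
      (congrArg Quiver.Hom.unop h2)
    exact ⟨g.op, POObj.Hom.ext (Quiver.Hom.unop_inj hg)⟩

theorem forgetPO_faithful (hκ : ℵ₀ ≤ κ) : (forgetPO κ).Faithful where
  map_injective h := Quiver.Hom.unop_inj (freeBool_map_injective hκ
    (congrArg (fun k => k.hom.unop) h))

theorem inftyForgetPO_full : inftyForgetPO.{u}.Full where
  map_surjective {X Y} f := by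
    obtain ⟨h, h1, h2⟩ := f.mono
    obtain ⟨g, hg⟩ := exists_map_eq aleph0_le_infty f.hom.unop.hom h.unop.hom
      (congrArg (fun k => k.unop.hom) h1) (congrArg (fun k => k.unop.hom) h2)
    exact ⟨Quiver.Hom.op (X := Y.unop) (Y := X.unop) (ObjectProperty.homMk g),
      POObj.Hom.ext (Quiver.Hom.unop_inj (ObjectProperty.hom_ext _ hg))⟩

theorem inftyForgetPO_faithful : inftyForgetPO.{u}.Faithful where
  map_injective h := Quiver.Hom.unop_inj (ObjectProperty.hom_ext _
    (freeBool_map_injective aleph0_le_infty (congrArg (fun k => k.hom.unop.hom) h)))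

end Upper

end KBorel

theorem mainTheorem7 :
    (∀ κ : Cardinal.{u}, κ.IsRegular →
      (∀ (X : KBorel.BorPlusLoc κ) (B : KBorel.BorelSet ((KBorel.forgetBor κ).obj X)),
        KBorel.IsUpper ((KBorel.forgetPO κ).obj X) B ↔ KBorel.IsPositive X B) ∧
      (KBorel.forgetPO κ).Full ∧ (KBorel.forgetPO κ).Faithful) ∧
    ((∀ (X : KBorel.InftyBorPlusLoc.{u})
        (B : KBorel.InftyBorelSet (KBorel.inftyForgetBor.obj X)),
        KBorel.InftyIsUpper (KBorel.inftyForgetPO.obj X) B ↔ KBorel.InftyIsPositive X B) ∧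
      KBorel.inftyForgetPO.{u}.Full ∧ KBorel.inftyForgetPO.{u}.Faithful) :=
  ⟨fun _ hκ => ⟨fun _ B => KBorel.upper_iff_mem_range_freeUnit hκ.aleph0_le B,
      KBorel.forgetPO_full hκ.aleph0_le, KBorel.forgetPO_faithful hκ.aleph0_le⟩,
    fun _ B => KBorel.upper_iff_mem_range_freeUnit KBorel.aleph0_le_infty B,
    KBorel.inftyForgetPO_full, KBorel.inftyForgetPO_faithful⟩
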